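/- \textbf{Setting.} For $M>0$, $r>0$, $x\in\mathbf R^2$ and a rectangular coordinate system $(y_1,y_2)$ on $\mathbf R^2$ let $Z_r(x)=\{y:|x_1-y_1|<r,\ |x_2-y_2|<(4M+2)r\}$. For an open set $\Omega$ and $x\in\partial\Omega$, $Z_r(x)$ is a coordinate cylinder for $\partial\Omega$ if there is a function $\phi:\mathbf R\to\mathbf R$, Lipschitz with constant $M$, such that, in these coordinates, $\partial\Omega\cap Z_r(x)=\{y_2=\phi(y_1)\}\cap Z_r(x)$ and $\Omega\cap Z_r(x)=\{y_2>\phi(y_1)\}\cap Z_r(x)$. A Lipschitz domain is a bounded connected nonempty open set $\Omega\subset\mathbf R^2$ for which there are $M$, $r_0>0$ and finitely many coordinate cylinders $Z_{r_0}(x_1),\dots,Z_{r_0}(x_N)$ covering $\partial\Omega$ (each in its own coordinate system) such that every $Z_{101r_0}(x_i)$ is also a coordinate cylinder. The number $M$, the scale $r_0$ and the collection of these cylinders form the global character of $\Omega$. Let $\sigma$ be arc length on $\partial\Omega$ and $d(y)=\operatorname{dist}(y,\partial\Omega)$. Fix $\alpha>0$; for a function $v$ on $\Omega$ and $x\in\partial\Omega$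 let $v^*(x)=\sup\{|v(y)|:y\in\Omega,\ |x-y|<(1+\alpha)d(y)\}\in[0,\infty]$, where $\sup\emptyset=0$. The Lam\'e operator is $(Lu)^a=\sum_{i,j,b}\partial_i(a^{ij}_{ab}\,\partial_ju^b)$, $a^{ij}_{ab}=\mu\delta_{ij}\delta_{ab}+s\,\delta_{ib}\delta_{ja}+(\lambda+\mu-s)\delta_{ia}\delta_{jb}$ (that is, $L=\mu\Delta+(\lambda+\mu)\nabla\operatorname{div}$), with $s\in[0,\mu]$, $\mu>0$ and $2\mu+2\lambda>0$. \textbf{Statement.} Let $\Omega\subset\mathbf R^2$ be a Lipschitz domain, let $K\subset\Omega$ be compact and nonempty, let $0<p<1$ and let $q$ be defined by $1/q=1/p-1$. If $u\in C^2(\Omega;\mathbf R^2)$ satisfies $Lu=0$ in $\Omega$ and $(\nabla u)^*\in L^p(\partial\Omega,\sigma)$, then $$\|u^*\|_{L^q(\partial\Omega)}\le C\Big(\|(\nabla u)^*\|_{L^p(\partial\Omega)}+r_0^{1/p-1}\sup_K|u|\Big).$$ The constant $C$ is finite and depends only on $p$, the aperture $\alpha$, the global character of $\Omega$, the set $K$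 and a positive lower bound for the distance from $K$ to $\partial\Omega$; in particular it does not depend on $u$ or on the Lam\'e parameters. -/

import Mathlib

open Set MeasureTheory
open scoped NNReal ENNReal

noncomputable section

/-- The Euclidean plane. -/
abbrev Plane : Type := EuclideanSpace ℝ (Fin 2)

/-! ### Lipschitz domains -/

/-- The cylinder `Z_r(x) = {y : |x' - y'| < r, |x₂ - y₂| < (4M+2) r}`, where the coordinates are
those of the rectangular coordinate system obtained from the standard one by moving the origin to
`x` and applying the linear isometry `F`. -/
def cyl (M : ℝ≥0) (F : Plane ≃ₗᵢ[ℝ] Plane) (x : Plane) (r : ℝ) : Set Plane :=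
  {y | |F (y - x) 0| < r ∧ |F (y - x) 1| < (4 * (M : ℝ) + 2) * r}

/-- `Z_r(x)` is a coordinate cylinder for `∂Ω`: inside it, `∂Ω` is the graph of a Lipschitz
function with constant `M`, and `Ω` is the region strictly above the graph. -/
def IsCoordCylinder (Ω : Set Plane) (M : ℝ≥0) (F : Plane ≃ₗᵢ[ℝ] Plane) (x : Plane) (r : ℝ) :
    Prop :=
  x ∈ frontier Ω ∧ ∃ φ : ℝ → ℝ, LipschitzWith M φ ∧
    frontier Ω ∩ cyl M F x r = {y | F (y - x) 1 = φ (F (y - x) 0)} ∩ cyl M F x r ∧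
    Ω ∩ cyl M F x r = {y | φ (F (y - x) 0) < F (y - x) 1} ∩ cyl M F x r

/-- A finite collection of cylinders `Z_{r₀}(x_i)`, `i = 1, …, N`, each with its own coordinate
system, together with the constant `M` and the scale `r₀`. -/
structure CylinderCollection where
  M : ℝ≥0
  M_pos : 0 < M
  r₀ : ℝ
  r₀_pos : 0 < r₀
  N : ℕ
  center : Fin N → Plane
  frame : Fin N → (Plane ≃ₗᵢ[ℝ] Plane)

/-- `Ω` is a bounded Lipschitz domain whose Lipschitz structure is given by the collection `𝒵`:
the cylinders `Z_{r₀}(x_i)` are coordinate cylinders for `∂Ω`, they cover `∂Ω`, and the dilated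
cylinders `Z_{101 r₀}(x_i)` are coordinate cylinders as well. -/
structure IsLipschitzDomain (𝒵 : CylinderCollection) (Ω : Set Plane) : Prop where
  isOpen : IsOpen Ω
  isBounded : Bornology.IsBounded Ω
  isConnected : IsConnected Ω
  isCoordCylinder : ∀ i, IsCoordCylinder Ω 𝒵.M (𝒵.frame i) (𝒵.center i) 𝒵.r₀
  isCoordCylinder_dilated : ∀ i, IsCoordCylinder Ω 𝒵.M (𝒵.frame i) (𝒵.center i) (101 * 𝒵.r₀)
  covers : frontier Ω ⊆ ⋃ i, cyl 𝒵.M (𝒵.frame i) (𝒵.center i) 𝒵.r₀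

/-- Surface measure (arc length) on `∂Ω`. -/
def surfaceMeasure (Ω : Set Plane) : Measure Plane :=
  (Measure.hausdorffMeasure 1).restrict (frontier Ω)

/-! ### The non-tangential maximal function -/

/-- The distance `d(y)` from `y` to `∂Ω`. -/
def bdryDist (Ω : Set Plane) (y : Plane) : ℝ := Metric.infDist y (frontier Ω)

/-- The non-tangential approach region `Γ(x)` with aperture `α`. -/
def approachRegion (Ω : Set Plane) (α : ℝ) (x : Plane) : Set Plane :=
  {y | y ∈ Ω ∧ dist x y < (1 + α) * bdryDist Ω y}

/-- The non-tangential maximal function `v*(x) = sup_{y ∈ Γ(x)} |v(y)|`, with values in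
`[0, ∞]`. -/
def nontan {V : Type*} [NormedAddCommGroup V] (Ω : Set Plane) (α : ℝ) (v : Plane → V)
    (x : Plane) : ℝ≥0∞ :=
  ⨆ y ∈ approachRegion Ω α x, ‖v y‖ₑ

/-! ### The Lamé system -/

/-- The partial derivative `∂f/∂x_i`. -/
def partialDeriv (i : Fin 2) (f : Plane → ℝ) (x : Plane) : ℝ :=
  fderiv ℝ f x (EuclideanSpace.single i 1)

/-- The gradient of a vector field, as the matrix of all `∂u^β/∂x_j`, with the Euclidean norm
`|∇u| = (∑_{j,β} |∂u^β/∂x_j|²)^{1/2}`. -/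
def gradient2 (u : Plane → Plane) (x : Plane) : EuclideanSpace ℝ (Fin 2 × Fin 2) :=
  WithLp.toLp 2 fun jb => partialDeriv jb.1 (fun y => u y jb.2) x

/-- The Kronecker symbol. -/
def kron (i j : Fin 2) : ℝ := if i = j then 1 else 0

/-- The coefficients `a^{ij}_{ab}(s)` of the Lamé operator with parameters `mu` and `lam`. -/
def lameCoeff (mu lam s : ℝ) (i j a b : Fin 2) : ℝ :=
  mu * kron i j * kron a b + s * kron i b * kron j a + (lam + mu - s) * kron i a * kron j b

/-- The Lamé operator `(Lu)^a = ∑_{i,j,b} ∂_i (a^{ij}_{ab} ∂_j u^b)`. -/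
def lameOp (mu lam s : ℝ) (u : Plane → Plane) (x : Plane) : Plane :=
  WithLp.toLp 2 fun a => ∑ i, ∑ j, ∑ b,
    partialDeriv i (fun y => lameCoeff mu lam s i j a b * partialDeriv j (fun z => u z b) y) x

/-- The condition on the parameters (in dimension two) that makes the Lamé system elliptic. -/
structure LameElliptic (mu lam s : ℝ) : Prop where
  s_nonneg : 0 ≤ s
  s_le : s ≤ mu
  mu_pos : 0 < mu
  lam_cond : 0 < 2 * mu + 2 * lam

/-- `u` is a (classical) solution of `Lu = 0` in `Ω`. -/
structure IsLameSolution (mu lam s : ℝ) (Ω : Set Plane) (u : Plane → Plane) : Prop where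
  contDiffOn : ContDiffOn ℝ 2 u Ω
  lameOp_eq_zero : ∀ x ∈ Ω, lameOp mu lam s u x = 0

end

/-!
The estimate is a Sobolev-type inequality for non-tangential maximal functions, valid for arbitrary
differentiable vector fields; this is why its constant is independent of the Lamé parameters. Write `N_β`
for the maximal function of `∇u` with aperture `β` and `d` for the distance to `∂Ω`.

Two bounds for the gradient are available. First, every `z ∈ Ω` belongs to the approach regions of
all boundary points in an arc of length comparable to `d(z)`, so that
`|∇u(z)| ≲ ‖N_α‖_p d(z)^{-1/p}` (`norm_fderiv_le_bdryDist_rpow`). Secondly, given `y` in the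
approach region of `x`, the path from `y` in the vertical direction of a coordinate cylinder stays
in a wider approach region of `x`, so that `|∇u| ≤ N_β(x)` along it. On this path `d` grows linearly
(`exists_vertical`), and integrating the smaller of the two bounds gives an increment of at most a
multiple of `‖N_α‖_p^p N_β(x)^{1-p}` (`norm_sub_le_of_norm_deriv_le_min`).

The endpoint of the path is at a definite distance from `∂Ω`. From there the oscillation of `u` up
to a point of `K` is bounded by the first bound for the gradient, along a chain of segments whose
number depends only on the cylinders (`exists_norm_sub_le`): `Ω` is connected and contained in a
fixed ball, hence any two points are joined by a bounded number of small steps, each of which can be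
lifted away from the boundary. Altogether, almost everywhere on `∂Ω` (`exists_nontan_le`),
`u* ≤ |u(k)| + C ‖N_α‖_p + C ‖N_α‖_p^p N_β^{1-p}`.

Since `(1 - p) q = p`, raising to the power `q` and integrating leaves `∫ N_β^p`, which is bounded
by a multiple of `∫ N_α^p` (`lintegral_nontan_rpow_le`). This change of aperture follows from the
Ahlfors regularity of arc length and a Vitali covering of the superlevel sets.
-/

namespace LipschitzPlane

variable {𝒵 : CylinderCollection} {Ω : Set Plane}

/-! ### Geometry of a Lipschitz domain -/

lemma abs_apply_le (v : Plane) (i : Fin 2) : |v i| ≤ ‖v‖ := by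
  simpa using PiLp.norm_apply_le v i

lemma norm_le_abs_add_abs (v : Plane) : ‖v‖ ≤ |v 0| + |v 1| := by
  rw [EuclideanSpace.norm_eq]
  apply Real.sqrt_le_iff.2
  refine ⟨by positivity, ?_⟩
  simp only [Fin.sum_univ_two, Real.norm_eq_abs]
  nlinarith [abs_nonneg (v 0), abs_nonneg (v 1)]

/-- A bound for `|y|` on the closure of any Lipschitz domain described by the collection `𝒵`. -/
noncomputable def outerRadius (𝒵 : CylinderCollection) : ℝ :=
  ∑ i, ‖𝒵.center i‖ + (4 * (𝒵.M : ℝ) + 3) * 𝒵.r₀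

lemma outerRadius_pos (𝒵 : CylinderCollection) : 0 < outerRadius 𝒵 := by
  have := 𝒵.r₀_pos
  unfold outerRadius
  positivity

lemma frontier_nonempty (h : IsLipschitzDomain 𝒵 Ω) : (frontier Ω).Nonempty := by
  refine nonempty_frontier_iff.2 ⟨h.isConnected.nonempty, fun hu => ?_⟩
  have hb := h.isBounded
  rw [hu] at hb
  exact NormedSpace.unbounded_univ ℝ Plane hb

lemma isCompact_frontier (h : IsLipschitzDomain 𝒵 Ω) : IsCompact (frontier Ω) :=
  Metric.isCompact_of_isClosed_isBounded isClosed_frontier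
    (h.isBounded.closure.subset frontier_subset_closure)

lemma exists_nearest (h : IsLipschitzDomain 𝒵 Ω) (y : Plane) :
    ∃ w ∈ frontier Ω, bdryDist Ω y = dist y w :=
  (isCompact_frontier h).exists_infDist_eq_dist (frontier_nonempty h) y

lemma bdryDist_nonneg (Ω : Set Plane) (y : Plane) : 0 ≤ bdryDist Ω y := Metric.infDist_nonneg

lemma bdryDist_le_dist {y w : Plane} (hw : w ∈ frontier Ω) : bdryDist Ω y ≤ dist y w :=
  Metric.infDist_le_dist_of_mem hw

lemma bdryDist_le_add (Ω : Set Plane) (y z : Plane) :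
    bdryDist Ω y ≤ bdryDist Ω z + dist y z := Metric.infDist_le_infDist_add_dist

lemma bdryDist_pos (h : IsLipschitzDomain 𝒵 Ω) {y : Plane} (hy : y ∈ Ω) : 0 < bdryDist Ω y := by
  obtain ⟨w, hw, hd⟩ := exists_nearest h y
  rw [hd, dist_pos]
  rintro rfl
  rw [h.isOpen.frontier_eq] at hw
  exact hw.2 hy

lemma subset_of_disjoint_frontier (hΩ : IsOpen Ω) {s : Set Plane} (hs : IsPreconnected s)
    (hd : Disjoint (frontier Ω) s) (hne : (s ∩ Ω).Nonempty) : s ⊆ Ω := by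
  refine hs.subset_left_of_subset_union hΩ isClosed_closure.isOpen_compl
    (disjoint_left.2 fun x hx hx' => hx' (subset_closure hx)) ?_ hne
  intro x hx
  by_cases h : x ∈ Ω
  · exact Or.inl h
  · refine Or.inr fun hc => disjoint_left.1 hd ?_ hx
    rw [hΩ.frontier_eq]
    exact ⟨hc, h⟩

lemma mem_of_dist_lt (h : IsLipschitzDomain 𝒵 Ω) {y z : Plane} (hy : y ∈ Ω)
    (hz : dist z y < bdryDist Ω y) : z ∈ Ω := by
  refine subset_of_disjoint_frontier h.isOpen (convex_ball y (bdryDist Ω y)).isPreconnected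
    (disjoint_left.2 fun w hw hw' => ?_) ⟨y, Metric.mem_ball_self (bdryDist_pos h hy), hy⟩ hz
  have h1 := bdryDist_le_dist (y := y) hw
  rw [Metric.mem_ball, dist_comm] at hw'
  linarith

lemma norm_le_of_mem_frontier (h : IsLipschitzDomain 𝒵 Ω) {w : Plane} (hw : w ∈ frontier Ω) :
    ‖w‖ ≤ outerRadius 𝒵 := by
  obtain ⟨i, hi⟩ := mem_iUnion.1 (h.covers hw)
  have h1 : ‖w‖ ≤ ‖𝒵.center i‖ + ‖w - 𝒵.center i‖ := by
    simpa using norm_add_le (𝒵.center i) (w - 𝒵.center i)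
  have h2 : ‖w - 𝒵.center i‖ ≤ (4 * (𝒵.M : ℝ) + 3) * 𝒵.r₀ := by
    rw [← (𝒵.frame i).norm_map]
    refine (norm_le_abs_add_abs _).trans ?_
    have := hi.1
    have := hi.2
    linarith
  have h3 : ‖𝒵.center i‖ ≤ ∑ i, ‖𝒵.center i‖ :=
    Finset.single_le_sum (f := fun i => ‖𝒵.center i‖) (fun _ _ => norm_nonneg _)
      (Finset.mem_univ i)
  unfold outerRadius
  linarith

lemma norm_le_of_mem (h : IsLipschitzDomain 𝒵 Ω) {y : Plane} (hy : y ∈ Ω) :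
    ‖y‖ ≤ outerRadius 𝒵 := by
  by_contra! hlt
  have hR := outerRadius_pos 𝒵
  have hsub : (fun t : ℝ => t • y) '' Ici 1 ⊆ Ω := by
    refine subset_of_disjoint_frontier h.isOpen
      (isPreconnected_Ici.image _ (by fun_prop)) (disjoint_left.2 ?_)
      ⟨y, ⟨1, by simp, by simp⟩, hy⟩
    rintro w hw ⟨t, ht, rfl⟩
    have h1 := norm_le_of_mem_frontier h hw
    rw [norm_smul, Real.norm_eq_abs] at h1
    have h2 : 1 ≤ |t| := le_trans ht (le_abs_self t)
    nlinarith [norm_nonneg y]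
  obtain ⟨D, hD⟩ := h.isBounded.exists_norm_le
  have h3 := hD _ (hsub ⟨1 + |D| / outerRadius 𝒵, by simp; positivity, rfl⟩)
  rw [norm_smul, Real.norm_eq_abs, abs_of_nonneg (by positivity)] at h3
  have h4 : (1 + |D| / outerRadius 𝒵) * outerRadius 𝒵 = outerRadius 𝒵 + |D| := by field_simp
  have h5 : (1 + |D| / outerRadius 𝒵) * outerRadius 𝒵 ≤ (1 + |D| / outerRadius 𝒵) * ‖y‖ := by
    gcongr
  linarith [le_abs_self D]

lemma bdryDist_le (h : IsLipschitzDomain 𝒵 Ω) {y : Plane} (hy : y ∈ Ω) :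
    bdryDist Ω y ≤ 2 * outerRadius 𝒵 := by
  obtain ⟨w, hw, hd⟩ := exists_nearest h y
  rw [hd]
  have := dist_le_norm_add_norm y w
  linarith [norm_le_of_mem h hy, norm_le_of_mem_frontier h hw]

/-- The function whose graph describes `∂Ω` in the dilated cylinder number `i`. -/
lemma exists_graph (h : IsLipschitzDomain 𝒵 Ω) (i : Fin 𝒵.N) :
    ∃ φ : ℝ → ℝ, (∀ a b, |φ a - φ b| ≤ 𝒵.M * |a - b|) ∧ φ 0 = 0 ∧
      (∀ z ∈ cyl 𝒵.M (𝒵.frame i) (𝒵.center i) (101 * 𝒵.r₀), z ∈ frontier Ω ↔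
        𝒵.frame i (z - 𝒵.center i) 1 = φ (𝒵.frame i (z - 𝒵.center i) 0)) ∧
      (∀ z ∈ cyl 𝒵.M (𝒵.frame i) (𝒵.center i) (101 * 𝒵.r₀), z ∈ Ω ↔
        φ (𝒵.frame i (z - 𝒵.center i) 0) < 𝒵.frame i (z - 𝒵.center i) 1) := by
  obtain ⟨hc, φ, hφ, h1, h2⟩ := h.isCoordCylinder_dilated i
  have hr := 𝒵.r₀_pos
  have h1' : ∀ z ∈ cyl 𝒵.M (𝒵.frame i) (𝒵.center i) (101 * 𝒵.r₀), z ∈ frontier Ω ↔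
        𝒵.frame i (z - 𝒵.center i) 1 = φ (𝒵.frame i (z - 𝒵.center i) 0) := fun z hz => by
    have := Set.ext_iff.1 h1 z
    simpa [hz] using this
  refine ⟨φ, fun a b => ?_, ?_, h1', fun z hz => ?_⟩
  · simpa [Real.dist_eq] using hφ.dist_le_mul a b
  · have := (h1' (𝒵.center i) ⟨by simp; positivity, by simp; positivity⟩).1 hc
    simpa using this.symm
  · have := Set.ext_iff.1 h2 z
    simpa [hz] using this

/-- In a coordinate cylinder the distance to `∂Ω` is comparable to the height above the graph. -/
lemma height_comparable (h : IsLipschitzDomain 𝒵 Ω) {i : Fin 𝒵.N} {φ : ℝ → ℝ}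
    (hφ : ∀ a b, |φ a - φ b| ≤ 𝒵.M * |a - b|) (hφ0 : φ 0 = 0)
    (hfr : ∀ z ∈ cyl 𝒵.M (𝒵.frame i) (𝒵.center i) (101 * 𝒵.r₀), z ∈ frontier Ω ↔
        𝒵.frame i (z - 𝒵.center i) 1 = φ (𝒵.frame i (z - 𝒵.center i) 0))
    (hin : ∀ z ∈ cyl 𝒵.M (𝒵.frame i) (𝒵.center i) (101 * 𝒵.r₀), z ∈ Ω ↔
        φ (𝒵.frame i (z - 𝒵.center i) 0) < 𝒵.frame i (z - 𝒵.center i) 1)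
    {z : Plane} (h0 : |𝒵.frame i (z - 𝒵.center i) 0| ≤ 4 * 𝒵.r₀)
    (h1 : |𝒵.frame i (z - 𝒵.center i) 1| ≤ (4 * 𝒵.M + 6) * 𝒵.r₀)
    (hz : φ (𝒵.frame i (z - 𝒵.center i) 0) < 𝒵.frame i (z - 𝒵.center i) 1) :
    z ∈ Ω ∧ 𝒵.frame i (z - 𝒵.center i) 1 - φ (𝒵.frame i (z - 𝒵.center i) 0) ≤
        (1 + 𝒵.M) * bdryDist Ω z ∧
      bdryDist Ω z ≤ 𝒵.frame i (z - 𝒵.center i) 1 - φ (𝒵.frame i (z - 𝒵.center i) 0) := by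
  have hr := 𝒵.r₀_pos
  have hM : (0 : ℝ) ≤ 𝒵.M := 𝒵.M.2
  have hMr : 0 ≤ (𝒵.M : ℝ) * 𝒵.r₀ := by positivity
  set a := 𝒵.frame i (z - 𝒵.center i) 0 with ha
  set b := 𝒵.frame i (z - 𝒵.center i) 1 with hb
  have hφa : |φ a| ≤ 4 * (𝒵.M * 𝒵.r₀) := by
    have := hφ a 0
    rw [hφ0, sub_zero, sub_zero] at this
    nlinarith
  refine ⟨(hin z ⟨by rw [← ha]; linarith, by rw [← hb]; nlinarith⟩).2 hz, ?_, ?_⟩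
  · obtain ⟨w, hw, hd⟩ := exists_nearest h z
    rw [hd, dist_eq_norm, ← (𝒵.frame i).norm_map]
    have key : 𝒵.frame i (z - w) =
        𝒵.frame i (z - 𝒵.center i) - 𝒵.frame i (w - 𝒵.center i) := by
      rw [← map_sub]; congr 1; abel
    have k0 := abs_apply_le (𝒵.frame i (z - w)) 0
    have k1 := abs_apply_le (𝒵.frame i (z - w)) 1
    rw [key] at k0 k1 ⊢
    simp only [PiLp.sub_apply] at k0 k1
    rw [← ha] at k0
    rw [← hb] at k1
    set a' := 𝒵.frame i (w - 𝒵.center i) 0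
    set b' := 𝒵.frame i (w - 𝒵.center i) 1
    set D := ‖𝒵.frame i (z - 𝒵.center i) - 𝒵.frame i (w - 𝒵.center i)‖
    have hh : b - φ a ≤ (8 * 𝒵.M + 6) * 𝒵.r₀ := by
      linarith [le_abs_self b, neg_abs_le (φ a)]
    by_cases hwc : w ∈ cyl 𝒵.M (𝒵.frame i) (𝒵.center i) (101 * 𝒵.r₀)
    · have hg : b' = φ a' := (hfr w hwc).1 hw
      have := hφ a a'
      have h3 : b - φ a ≤ |b - b'| + |φ a - φ a'| := by
        rw [hg]
        linarith [le_abs_self (b - φ a'), neg_abs_le (φ a - φ a')]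
      nlinarith
    · have hD : 8 * 𝒵.r₀ ≤ D ∨ (8 * 𝒵.M + 6) * 𝒵.r₀ ≤ D := by
        by_contra! hcon
        refine hwc ⟨?_, ?_⟩
        · have : |a'| ≤ |a| + |a - a'| := by
            have := abs_sub a (a - a'); simpa using this
          change |a'| < _
          linarith
        · have : |b'| ≤ |b| + |b - b'| := by
            have := abs_sub b (b - b'); simpa using this
          change |b'| < _
          nlinarith
      have hD0 : 0 ≤ D := norm_nonneg _
      rcases hD with hD | hD <;> nlinarith
  · set w : Plane := 𝒵.center i + (𝒵.frame i).symm !₂[a, φ a] with hwdef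
    have hFw : 𝒵.frame i (w - 𝒵.center i) = !₂[a, φ a] := by simp [hwdef]
    have hwc : w ∈ cyl 𝒵.M (𝒵.frame i) (𝒵.center i) (101 * 𝒵.r₀) := by
      constructor
      · rw [hFw]; simp; linarith
      · rw [hFw]; simp; nlinarith
    have hw : w ∈ frontier Ω := (hfr w hwc).2 (by rw [hFw]; simp)
    refine (bdryDist_le_dist hw).trans ?_
    rw [dist_eq_norm, ← (𝒵.frame i).norm_map]
    have key : 𝒵.frame i (z - w) =
        𝒵.frame i (z - 𝒵.center i) - 𝒵.frame i (w - 𝒵.center i) := by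
      rw [← map_sub]; congr 1; abel
    refine (norm_le_abs_add_abs _).trans ?_
    rw [key, hFw]
    simp only [PiLp.sub_apply]
    rw [← ha, ← hb]
    simp [abs_of_pos (sub_pos.2 hz)]

/-- Near the boundary there is a direction `e`, the vertical one of a coordinate cylinder, along
which points move away from `∂Ω` at a linear rate, even after a small perturbation `v`. -/
lemma exists_vertical (h : IsLipschitzDomain 𝒵 Ω) {y : Plane} (hd : bdryDist Ω y < 𝒵.r₀) :
    ∃ e : Plane, ‖e‖ = 1 ∧ ∀ y' ∈ Ω, dist y' y ≤ 𝒵.r₀ → ∀ (v : Plane) (t : ℝ),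
      (1 + 𝒵.M) * ‖v‖ ≤ t → t ≤ 𝒵.r₀ →
      y' + v + t • e ∈ Ω ∧
        bdryDist Ω y' + t - (1 + 𝒵.M) * ‖v‖ ≤ (1 + 𝒵.M) * bdryDist Ω (y' + v + t • e) := by
  obtain ⟨x, hx, hyx⟩ := exists_nearest h y
  obtain ⟨i, hi⟩ := mem_iUnion.1 (h.covers hx)
  obtain ⟨φ, hφ, hφ0, hfr, hin⟩ := exists_graph h i
  have hr := 𝒵.r₀_pos
  have hM : (0 : ℝ) ≤ 𝒵.M := 𝒵.M.2
  refine ⟨(𝒵.frame i).symm !₂[0, 1], by simp [EuclideanSpace.norm_eq], ?_⟩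
  intro y' hy' hyy' v t hvt ht
  have key : 𝒵.frame i (y' - 𝒵.center i) =
      𝒵.frame i (x - 𝒵.center i) + 𝒵.frame i (y' - x) := by
    rw [← map_add]; congr 1; abel
  have hy'x : ‖𝒵.frame i (y' - x)‖ < 2 * 𝒵.r₀ := by
    rw [(𝒵.frame i).norm_map, ← dist_eq_norm]
    have := dist_triangle y' y x
    linarith
  have e0 := abs_apply_le (𝒵.frame i (y' - x)) 0
  have e1 := abs_apply_le (𝒵.frame i (y' - x)) 1
  have c0 := hi.1
  have c1 := hi.2
  have a0 : |𝒵.frame i (y' - 𝒵.center i) 0| < 3 * 𝒵.r₀ := by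
    rw [key, PiLp.add_apply]
    have := abs_add_le (𝒵.frame i (x - 𝒵.center i) 0) (𝒵.frame i (y' - x) 0)
    linarith
  have a1 : |𝒵.frame i (y' - 𝒵.center i) 1| < (4 * 𝒵.M + 4) * 𝒵.r₀ := by
    rw [key, PiLp.add_apply]
    have := abs_add_le (𝒵.frame i (x - 𝒵.center i) 1) (𝒵.frame i (y' - x) 1)
    linarith
  have hy'c := (hin y' ⟨by linarith, by nlinarith⟩).1 hy'
  obtain ⟨-, -, hdy⟩ := height_comparable h hφ hφ0 hfr hin (by linarith) (by linarith) hy'c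
  have hdpos := bdryDist_pos h hy'
  have key2 : 𝒵.frame i (y' + v + t • (𝒵.frame i).symm !₂[0, 1] - 𝒵.center i) =
      𝒵.frame i (y' - 𝒵.center i) + 𝒵.frame i v + t • !₂[0, 1] := by
    rw [← (𝒵.frame i).apply_symm_apply (t • !₂[0, 1]), ← map_add, ← map_add, map_smul]
    congr 1; abel
  have v0 := abs_apply_le (𝒵.frame i v) 0
  have v1 := abs_apply_le (𝒵.frame i v) 1
  rw [(𝒵.frame i).norm_map] at v0 v1
  have hv0 : ‖v‖ ≤ t := by nlinarith [norm_nonneg v]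
  have q0 : 𝒵.frame i (y' + v + t • (𝒵.frame i).symm !₂[0, 1] - 𝒵.center i) 0 =
      𝒵.frame i (y' - 𝒵.center i) 0 + 𝒵.frame i v 0 := by rw [key2]; simp
  have q1 : 𝒵.frame i (y' + v + t • (𝒵.frame i).symm !₂[0, 1] - 𝒵.center i) 1 =
      𝒵.frame i (y' - 𝒵.center i) 1 + 𝒵.frame i v 1 + t := by rw [key2]; simp
  set z := y' + v + t • (𝒵.frame i).symm !₂[0, 1]
  have hφv := hφ (𝒵.frame i (z - 𝒵.center i) 0) (𝒵.frame i (y' - 𝒵.center i) 0)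
  rw [q0, add_sub_cancel_left] at hφv
  have hMv : 𝒵.M * |𝒵.frame i v 0| ≤ 𝒵.M * ‖v‖ := by gcongr
  have hheight : bdryDist Ω y' + t - (1 + 𝒵.M) * ‖v‖ ≤ 𝒵.frame i (z - 𝒵.center i) 1 -
      φ (𝒵.frame i (z - 𝒵.center i) 0) := by
    rw [q0, q1]
    linarith [abs_le.1 hφv, abs_le.1 v1]
  obtain ⟨m1, m2, -⟩ := height_comparable h hφ hφ0 hfr hin (z := z)
    (by
      rw [q0]
      have := abs_add_le (𝒵.frame i (y' - 𝒵.center i) 0) (𝒵.frame i v 0)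
      linarith)
    (by
      rw [q1]
      have := abs_add_three (𝒵.frame i (y' - 𝒵.center i) 1) (𝒵.frame i v 1) t
      have : |t| = t := abs_of_nonneg (by linarith [norm_nonneg v])
      linarith)
    (by linarith)
  exact ⟨m1, hheight.trans m2⟩

/-! ### Ahlfors regularity of arc length -/

lemma surfaceMeasure_apply (Ω s : Set Plane) :
    surfaceMeasure Ω s = Measure.hausdorffMeasure 1 (s ∩ frontier Ω) :=
  Measure.restrict_apply' isClosed_frontier.measurableSet

lemma surfaceMeasure_mono_of_inter {s t : Set Plane} (hst : s ∩ frontier Ω ⊆ t) :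
    surfaceMeasure Ω s ≤ surfaceMeasure Ω t := by
  rw [surfaceMeasure_apply, surfaceMeasure_apply]
  exact measure_mono fun x hx => ⟨hst hx, hx.2⟩

/-- The boundary is covered by `N` Lipschitz graphs, so balls have at most linear measure. -/
lemma surfaceMeasure_closedBall_le (h : IsLipschitzDomain 𝒵 Ω) (x : Plane) (r : ℝ) :
    surfaceMeasure Ω (Metric.closedBall x r) ≤
      ENNReal.ofReal (2 * 𝒵.N * (1 + 𝒵.M) * r) := by
  have hr := 𝒵.r₀_pos
  choose φ hφ hφ0 hfr hin using exists_graph h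
  let g : Fin 𝒵.N → ℝ → Plane := fun i t => 𝒵.center i + (𝒵.frame i).symm !₂[t, φ i t]
  have hg : ∀ i, LipschitzWith (1 + 𝒵.M) (g i) := fun i => by
    refine LipschitzWith.of_dist_le_mul fun s t => ?_
    simp only [g, dist_add_left, LinearIsometryEquiv.dist_map]
    rw [dist_eq_norm, Real.dist_eq]
    refine (norm_le_abs_add_abs _).trans ?_
    have := hφ i s t
    simp only [PiLp.sub_apply, Matrix.cons_val_zero, Matrix.cons_val_one, NNReal.coe_add,
      NNReal.coe_one]
    linarith
  have hcov : Metric.closedBall x r ∩ frontier Ω ⊆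
      ⋃ i, g i '' Metric.closedBall (𝒵.frame i (x - 𝒵.center i) 0) r := by
    rintro z ⟨hz, hzf⟩
    obtain ⟨i, hi⟩ := mem_iUnion.1 (h.covers hzf)
    refine mem_iUnion.2 ⟨i, 𝒵.frame i (z - 𝒵.center i) 0, ?_, ?_⟩
    · rw [Metric.mem_closedBall, Real.dist_eq, ← PiLp.sub_apply, ← map_sub]
      refine (abs_apply_le _ 0).trans ?_
      rw [(𝒵.frame i).norm_map]
      simpa [dist_eq_norm] using hz
    · have hz1 := (hfr i z ⟨by linarith [hi.1], by nlinarith [hi.2, 𝒵.M.2]⟩).1 hzf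
      have : !₂[𝒵.frame i (z - 𝒵.center i) 0, φ i (𝒵.frame i (z - 𝒵.center i) 0)] =
          𝒵.frame i (z - 𝒵.center i) := by
        ext j; fin_cases j
        · simp
        · simpa using hz1.symm
      simp only [g]
      rw [this]
      simp
  rw [surfaceMeasure_apply]
  calc Measure.hausdorffMeasure 1 (Metric.closedBall x r ∩ frontier Ω)
      ≤ ∑ i, Measure.hausdorffMeasure 1
          (g i '' Metric.closedBall (𝒵.frame i (x - 𝒵.center i) 0) r) :=
        (measure_mono hcov).trans (measure_iUnion_fintype_le _ _)
    _ ≤ ∑ i : Fin 𝒵.N, ENNReal.ofReal (2 * (1 + 𝒵.M) * r) := by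
        refine Finset.sum_le_sum fun i _ => ?_
        refine ((hg i).hausdorffMeasure_image_le zero_le_one _).trans ?_
        rw [hausdorffMeasure_real, Real.volume_closedBall, ENNReal.rpow_one,
          ← ENNReal.ofReal_coe_nnreal, ← ENNReal.ofReal_mul (by positivity)]
        apply ENNReal.ofReal_le_ofReal
        push_cast
        linarith
    _ = ENNReal.ofReal (2 * 𝒵.N * (1 + 𝒵.M) * r) := by
        rw [Finset.sum_const, Finset.card_univ, Fintype.card_fin, nsmul_eq_mul,
          ← ENNReal.ofReal_natCast, ← ENNReal.ofReal_mul (by positivity)]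
        congr 1; ring

lemma le_surfaceMeasure_ball_of_le (h : IsLipschitzDomain 𝒵 Ω) {x : Plane} (hx : x ∈ frontier Ω)
    {r : ℝ} (hr0 : 0 < r) (hr : r ≤ 𝒵.r₀) :
    ENNReal.ofReal (2 * (r / (1 + 𝒵.M))) ≤ surfaceMeasure Ω (Metric.ball x r) := by
  have hM : (0 : ℝ) ≤ 𝒵.M := 𝒵.M.2
  obtain ⟨i, hi⟩ := mem_iUnion.1 (h.covers hx)
  obtain ⟨φ, hφ, hφ0, hfr, -⟩ := exists_graph h i
  let π : Plane → ℝ := fun z => 𝒵.frame i (z - 𝒵.center i) 0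
  have hπ : LipschitzWith 1 π := LipschitzWith.of_dist_le_mul fun z w => by
    simp only [π, Real.dist_eq, ← PiLp.sub_apply, ← map_sub]
    refine (abs_apply_le _ 0).trans ?_
    rw [(𝒵.frame i).norm_map]
    simp [dist_eq_norm]
  have hsub : Metric.ball (π x) (r / (1 + 𝒵.M)) ⊆ π '' (Metric.ball x r ∩ frontier Ω) := by
    intro t ht
    rw [Metric.mem_ball, Real.dist_eq] at ht
    have htr : (1 + 𝒵.M) * |t - π x| < r := by
      rw [lt_div_iff₀ (by positivity)] at ht; linarith
    have h1 : |t - π x| < r := by nlinarith [abs_nonneg (t - π x)]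
    set w : Plane := 𝒵.center i + (𝒵.frame i).symm !₂[t, φ t] with hw
    have hFw : 𝒵.frame i (w - 𝒵.center i) = !₂[t, φ t] := by simp [hw]
    have h2 : |t| < 2 * 𝒵.r₀ := by
      have := abs_add_le (t - π x) (π x)
      rw [sub_add_cancel] at this
      linarith [show |π x| < 𝒵.r₀ from hi.1]
    have h3 : |φ t| ≤ 𝒵.M * (2 * 𝒵.r₀) := by
      have := hφ t 0
      rw [hφ0, sub_zero, sub_zero] at this
      exact this.trans (by gcongr)
    have hMr : 0 ≤ (𝒵.M : ℝ) * 𝒵.r₀ := by have := 𝒵.r₀_pos; positivity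
    have hxφ := (hfr x ⟨by linarith [hi.1], by nlinarith [hi.2]⟩).1 hx
    refine ⟨w, ⟨?_, ?_⟩, by simp only [π, hFw, Matrix.cons_val_zero]⟩
    · rw [Metric.mem_ball, dist_eq_norm, ← (𝒵.frame i).norm_map]
      have key : 𝒵.frame i (w - x) =
          𝒵.frame i (w - 𝒵.center i) - 𝒵.frame i (x - 𝒵.center i) := by
        rw [← map_sub]; congr 1; abel
      refine (norm_le_abs_add_abs _).trans_lt ?_
      rw [key, hFw]
      simp only [PiLp.sub_apply, Matrix.cons_val_zero, Matrix.cons_val_one]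
      rw [hxφ]
      have := hφ t (π x)
      change |t - π x| + |φ t - φ (π x)| < r
      linarith
    · refine (hfr w ⟨?_, ?_⟩).2 (by simp [hFw])
      · rw [hFw]; simp; linarith [𝒵.r₀_pos]
      · rw [hFw]; simp; nlinarith [𝒵.r₀_pos]
  rw [surfaceMeasure_apply]
  have h1 := hπ.hausdorffMeasure_image_le zero_le_one (Metric.ball x r ∩ frontier Ω)
  rw [hausdorffMeasure_real] at h1
  simp only [ENNReal.coe_one, ENNReal.one_rpow, one_mul] at h1
  refine le_trans ?_ h1
  rw [← Real.volume_ball (a := π x)]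
  exact measure_mono hsub

/-- The constant in the lower Ahlfors bound, valid up to the size of the domain. -/
noncomputable def lowerConst (𝒵 : CylinderCollection) : ℝ :=
  𝒵.r₀ / (outerRadius 𝒵 * (1 + 𝒵.M))

lemma lowerConst_pos (𝒵 : CylinderCollection) : 0 < lowerConst 𝒵 := by
  have := 𝒵.r₀_pos
  have := outerRadius_pos 𝒵
  unfold lowerConst
  positivity

lemma le_surfaceMeasure_ball (h : IsLipschitzDomain 𝒵 Ω) {x : Plane} (hx : x ∈ frontier Ω)
    {r : ℝ} (hr0 : 0 < r) (hr : r ≤ 2 * outerRadius 𝒵) :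
    ENNReal.ofReal (lowerConst 𝒵 * r) ≤ surfaceMeasure Ω (Metric.ball x r) := by
  have hr₀ := 𝒵.r₀_pos
  have hR := outerRadius_pos 𝒵
  have hM : (0 : ℝ) ≤ 𝒵.M := 𝒵.M.2
  have hrR : 𝒵.r₀ ≤ 2 * outerRadius 𝒵 := by
    have : 0 ≤ ∑ i, ‖𝒵.center i‖ := by positivity
    unfold outerRadius
    nlinarith
  -- Shrinking the radius by the factor `r₀ / (2R)` brings it below the scale of the cylinders.
  have h1 : r * (𝒵.r₀ / (2 * outerRadius 𝒵)) ≤ 𝒵.r₀ := by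
    rw [mul_div_assoc', div_le_iff₀ (by positivity)]
    nlinarith
  have h2 : r * (𝒵.r₀ / (2 * outerRadius 𝒵)) ≤ r :=
    mul_le_of_le_one_right hr0.le ((div_le_one (by positivity)).2 hrR)
  refine le_trans (le_of_eq ?_) ((le_surfaceMeasure_ball_of_le h hx (by positivity) h1).trans
    (measure_mono (Metric.ball_subset_ball h2)))
  congr 1
  unfold lowerConst
  field_simp

/-- A bound for the total length of the boundary. -/
lemma surfaceMeasure_univ_le (h : IsLipschitzDomain 𝒵 Ω) :
    surfaceMeasure Ω univ ≤ ENNReal.ofReal (2 * 𝒵.N * (1 + 𝒵.M) * outerRadius 𝒵) := by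
  refine le_trans (surfaceMeasure_mono_of_inter ?_)
    (surfaceMeasure_closedBall_le h 0 (outerRadius 𝒵))
  intro x hx
  simpa using norm_le_of_mem_frontier h hx.2

variable {V : Type*} [NormedAddCommGroup V]

/-! ### The non-tangential maximal function -/

lemma lt_nontan_iff {α : ℝ} {v : Plane → V} {x : Plane} {l : ℝ≥0∞} :
    l < nontan Ω α v x ↔ ∃ y ∈ Ω, dist x y < (1 + α) * bdryDist Ω y ∧ l < ‖v y‖ₑ := by
  simp [nontan, lt_iSup_iff, approachRegion, and_assoc]

lemma enorm_le_nontan {α : ℝ} {v : Plane → V} {x y : Plane} (hy : y ∈ Ω)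
    (hxy : dist x y < (1 + α) * bdryDist Ω y) : ‖v y‖ₑ ≤ nontan Ω α v x :=
  le_iSup₂_of_le y ⟨hy, hxy⟩ le_rfl

/-- The non-tangential maximal function is lower semicontinuous, whatever `v` is. -/
lemma measurable_nontan (Ω : Set Plane) (α : ℝ) (v : Plane → V) :
    Measurable (nontan Ω α v) := by
  refine measurable_of_Ioi fun l => ?_
  have : nontan Ω α v ⁻¹' Ioi l =
      ⋃ y ∈ {y | y ∈ Ω ∧ l < ‖v y‖ₑ}, Metric.ball y ((1 + α) * bdryDist Ω y) := by
    ext x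
    simp only [mem_preimage, mem_Ioi, lt_nontan_iff, mem_iUnion, Metric.mem_ball, mem_ofPred_eq,
      exists_prop]
    constructor
    · rintro ⟨y, h1, h2, h3⟩; exact ⟨y, ⟨h1, h3⟩, h2⟩
    · rintro ⟨y, ⟨h1, h3⟩, h2⟩; exact ⟨y, h1, h2, h3⟩
  rw [this]
  exact (isOpen_biUnion fun y _ => Metric.isOpen_ball).measurableSet

/-- Every value `v z` is seen from a boundary arc of length comparable to `d(z)`. -/
lemma enorm_le_nontan_of_mem_ball {α : ℝ} {v : Plane → V} {z w x : Plane} (hz : z ∈ Ω)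
    (hzw : bdryDist Ω z = dist z w) (hx : x ∈ Metric.ball w (min α 1 * bdryDist Ω z)) :
    ‖v z‖ₑ ≤ nontan Ω α v x := by
  refine enorm_le_nontan hz ?_
  rw [Metric.mem_ball] at hx
  have h1 := dist_triangle x w z
  rw [dist_comm w z, ← hzw] at h1
  have h2 : min α 1 * bdryDist Ω z ≤ α * bdryDist Ω z :=
    mul_le_mul_of_nonneg_right (min_le_left _ _) (bdryDist_nonneg _ _)
  linarith

/-- The constant in the comparison of superlevel sets for the apertures `α` and `β`. -/
noncomputable def apertureConst (𝒵 : CylinderCollection) (α β : ℝ) : ℝ :=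
  2 * 𝒵.N * (1 + 𝒵.M) * (5 * (2 + β)) / (lowerConst 𝒵 * min α 1)

/-- Change of aperture on superlevel sets. A point where the maximal function of aperture `β`
exceeds `l` lies in a ball around the foot point of some `y` with `|v y| > l`, and the
maximal function of aperture `α` exceeds `l` on a proportional ball; a Vitali covering argument
compares the two unions. -/
lemma surfaceMeasure_lt_nontan_le (h : IsLipschitzDomain 𝒵 Ω) {α β : ℝ} (hα : 0 < α) (hβ : 0 < β)
    (v : Plane → V) (l : ℝ≥0∞) :
    surfaceMeasure Ω {x | l < nontan Ω β v x} ≤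
      ENNReal.ofReal (apertureConst 𝒵 α β) * surfaceMeasure Ω {x | l < nontan Ω α v x} := by
  choose f hf hfd using exists_nearest h
  have ha : 0 < min α 1 := lt_min hα one_pos
  have hκ := lowerConst_pos 𝒵
  obtain ⟨u, hut, hdisj, hcov⟩ := Vitali.exists_disjoint_subfamily_covering_enlargement_closedBall
    {y | y ∈ Ω ∧ l < ‖v y‖ₑ} f (fun y => (2 + β) * bdryDist Ω y)
    ((2 + β) * (2 * outerRadius 𝒵))
    (fun y hy => mul_le_mul_of_nonneg_left (bdryDist_le h hy.1) (by positivity)) 5 (by norm_num)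
  have hpos : ∀ y ∈ u, 0 < bdryDist Ω y := fun y hy => bdryDist_pos h (hut hy).1
  have hucount : u.Countable := hdisj.countable_of_nonempty_interior fun y hy =>
    ⟨f y, Metric.ball_subset_interior_closedBall
      (Metric.mem_ball_self (mul_pos (by positivity) (hpos y hy)))⟩
  have hdisj' : u.PairwiseDisjoint fun y => Metric.ball (f y) (min α 1 * bdryDist Ω y) := by
    intro y hy z hz hyz
    have hsub : ∀ y : Plane, Metric.ball (f y) (min α 1 * bdryDist Ω y) ⊆
        Metric.closedBall (f y) ((2 + β) * bdryDist Ω y) := fun y =>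
      Metric.ball_subset_closedBall.trans (Metric.closedBall_subset_closedBall
        (mul_le_mul_of_nonneg_right (by linarith [min_le_right α 1]) (bdryDist_nonneg _ _)))
    exact (hdisj hy hz hyz).mono (hsub y) (hsub z)
  have hstep : ∀ y ∈ u,
      surfaceMeasure Ω (Metric.closedBall (f y) (5 * ((2 + β) * bdryDist Ω y))) ≤
      ENNReal.ofReal (apertureConst 𝒵 α β) *
        surfaceMeasure Ω (Metric.ball (f y) (min α 1 * bdryDist Ω y)) := by
    intro y hy
    have hy' := hpos y hy
    have h1 : min α 1 * bdryDist Ω y ≤ 2 * outerRadius 𝒵 :=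
      (mul_le_of_le_one_left hy'.le (min_le_right _ _)).trans (bdryDist_le h (hut hy).1)
    refine (surfaceMeasure_closedBall_le h _ _).trans (le_trans (le_of_eq ?_)
      (mul_le_mul_right (le_surfaceMeasure_ball h (hf y) (mul_pos ha hy') h1) _))
    rw [← ENNReal.ofReal_mul (by unfold apertureConst; positivity)]
    congr 1
    unfold apertureConst
    field_simp
  calc surfaceMeasure Ω {x | l < nontan Ω β v x}
      ≤ surfaceMeasure Ω (⋃ y ∈ u, Metric.closedBall (f y) (5 * ((2 + β) * bdryDist Ω y))) := by
        refine surfaceMeasure_mono_of_inter ?_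
        rintro x ⟨hx, -⟩
        obtain ⟨y, hy, hxy, hl⟩ := lt_nontan_iff.1 hx
        obtain ⟨z, hz, hsub⟩ := hcov y ⟨hy, hl⟩
        refine mem_biUnion hz (hsub ?_)
        rw [Metric.mem_closedBall]
        have := dist_triangle x y (f y)
        rw [← hfd y] at this
        linarith
    _ ≤ ∑' y : u, surfaceMeasure Ω
          (Metric.closedBall (f y) (5 * ((2 + β) * bdryDist Ω y))) :=
        measure_biUnion_le _ hucount _
    _ ≤ ∑' y : u, ENNReal.ofReal (apertureConst 𝒵 α β) *
          surfaceMeasure Ω (Metric.ball (f y) (min α 1 * bdryDist Ω y)) :=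
        ENNReal.tsum_le_tsum fun y => hstep y y.2
    _ = ENNReal.ofReal (apertureConst 𝒵 α β) *
          surfaceMeasure Ω (⋃ y ∈ u, Metric.ball (f y) (min α 1 * bdryDist Ω y)) := by
        rw [ENNReal.tsum_mul_left, measure_biUnion hucount hdisj'
          fun y _ => Metric.isOpen_ball.measurableSet]
    _ ≤ _ := by
        gcongr
        refine iUnion₂_subset fun y hy x hx => ?_
        exact (hut hy).2.trans_le (enorm_le_nontan_of_mem_ball (hut hy).1 (hfd y) hx)

/-- The layer cake formula for functions with values in `[0, ∞]`. -/
lemma lintegral_eq_lintegral_meas_ofReal_lt {X : Type*} [MeasurableSpace X] (μ : Measure X)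
    [SFinite μ] {f : X → ℝ≥0∞} (hf : Measurable f) :
    ∫⁻ x, f x ∂μ = ∫⁻ t in Ioi (0 : ℝ), μ {x | ENNReal.ofReal t < f x} := by
  have hvol : ∀ c : ℝ≥0∞, volume.restrict (Ioi (0 : ℝ)) {t | ENNReal.ofReal t < c} = c := by
    intro c
    rw [Measure.restrict_apply' measurableSet_Ioi]
    induction c with
    | top => simp
    | coe c =>
      have : {t : ℝ | ENNReal.ofReal t < c} ∩ Ioi 0 = Ioo 0 (c : ℝ) := by
        ext t
        simp only [mem_inter_iff, mem_ofPred_eq, mem_Ioi, mem_Ioo]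
        rw [and_comm]
        refine and_congr_right fun ht => ?_
        rw [← ENNReal.ofReal_coe_nnreal, ENNReal.ofReal_lt_ofReal_iff_of_nonneg ht.le]
      rw [this, Real.volume_Ioo, sub_zero, ENNReal.ofReal_coe_nnreal]
  have hS : MeasurableSet {z : X × ℝ | ENNReal.ofReal z.2 < f z.1} :=
    measurableSet_lt (by fun_prop) (by fun_prop)
  have h1 := Measure.prod_apply (μ := μ) (ν := volume.restrict (Ioi (0 : ℝ))) hS
  have h2 := Measure.prod_apply_symm (μ := μ) (ν := volume.restrict (Ioi (0 : ℝ))) hS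
  rw [h1] at h2
  simp only [preimage_ofPred_eq, hvol] at h2
  exact h2

/-- Change of aperture in `L^p`. -/
lemma lintegral_nontan_rpow_le (h : IsLipschitzDomain 𝒵 Ω) {α β p : ℝ} (hα : 0 < α) (hβ : 0 < β)
    (hp : 0 < p) (v : Plane → V) :
    ∫⁻ x, nontan Ω β v x ^ p ∂surfaceMeasure Ω ≤
      ENNReal.ofReal (apertureConst 𝒵 α β) *
        ∫⁻ x, nontan Ω α v x ^ p ∂surfaceMeasure Ω := by
  have : IsFiniteMeasure (surfaceMeasure Ω) :=
    ⟨(surfaceMeasure_univ_le h).trans_lt ENNReal.ofReal_lt_top⟩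
  rw [lintegral_eq_lintegral_meas_ofReal_lt _ ((measurable_nontan Ω β v).pow_const p),
    lintegral_eq_lintegral_meas_ofReal_lt _ ((measurable_nontan Ω α v).pow_const p),
    ← lintegral_const_mul' _ _ ENNReal.ofReal_ne_top]
  refine lintegral_mono fun t => ?_
  have hlt : ∀ a : ℝ≥0∞, ENNReal.ofReal t < a ^ p ↔ ENNReal.ofReal t ^ p⁻¹ < a := fun a => by
    rw [ENNReal.rpow_inv_lt_iff hp]
  simp only [hlt]
  exact surfaceMeasure_lt_nontan_le h hα hβ v _

/-- The pointwise bound `|v(z)|^p d(z) ≲ ‖v*‖_p^p`. -/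
lemma enorm_rpow_mul_bdryDist_le (h : IsLipschitzDomain 𝒵 Ω) {α p : ℝ} (hα : 0 < α)
    (hp : 0 < p) (v : Plane → V) {z : Plane} (hz : z ∈ Ω) :
    ‖v z‖ₑ ^ p * ENNReal.ofReal (lowerConst 𝒵 * (min α 1 * bdryDist Ω z)) ≤
      ∫⁻ x, nontan Ω α v x ^ p ∂surfaceMeasure Ω := by
  obtain ⟨w, hw, hzw⟩ := exists_nearest h z
  have hd := bdryDist_pos h hz
  have h1 : min α 1 * bdryDist Ω z ≤ 2 * outerRadius 𝒵 :=
    (mul_le_of_le_one_left hd.le (min_le_right _ _)).trans (bdryDist_le h hz)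
  calc ‖v z‖ₑ ^ p * ENNReal.ofReal (lowerConst 𝒵 * (min α 1 * bdryDist Ω z))
      ≤ ‖v z‖ₑ ^ p * surfaceMeasure Ω (Metric.ball w (min α 1 * bdryDist Ω z)) := by
        gcongr
        exact le_surfaceMeasure_ball h hw (mul_pos (lt_min hα one_pos) hd) h1
    _ = ∫⁻ _ in Metric.ball w (min α 1 * bdryDist Ω z), ‖v z‖ₑ ^ p ∂surfaceMeasure Ω := by
        rw [setLIntegral_const]
    _ ≤ ∫⁻ x in Metric.ball w (min α 1 * bdryDist Ω z),
          nontan Ω α v x ^ p ∂surfaceMeasure Ω := by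
        refine setLIntegral_mono ((measurable_nontan Ω α v).pow_const p) fun x hx => ?_
        gcongr
        exact enorm_le_nontan_of_mem_ball hz hzw hx
    _ ≤ _ := setLIntegral_le_lintegral _ _

/-! ### Oscillation away from the boundary -/

/-- If `f` oscillates by at most `A` on points of a preconnected set at mutual distance less than
`2ρ`, then its total oscillation is controlled by the number of `ρ`-balls needed to cover the
set. -/
lemma dist_le_card_mul_of_isPreconnected {X Y : Type*} [PseudoMetricSpace X] [PseudoMetricSpace Y]
    {s : Set X} (hs : IsPreconnected s) (T : Finset X) {ρ A : ℝ} (hA : 0 ≤ A)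
    (hT : s ⊆ ⋃ c ∈ T, Metric.ball c ρ) {f : X → Y}
    (hf : ∀ x ∈ s, ∀ y ∈ s, dist x y < 2 * ρ → dist (f x) (f y) ≤ A)
    {x y : X} (hx : x ∈ s) (hy : y ∈ s) : dist (f x) (f y) ≤ T.card * A := by
  classical
  -- The balls are the vertices of a graph; two of them are adjacent if they meet inside `s`.
  let G : SimpleGraph T := SimpleGraph.mk
    (fun c c' => c ≠ c' ∧ (s ∩ (Metric.ball (c : X) ρ ∩ Metric.ball (c' : X) ρ)).Nonempty)
    ⟨fun c c' hcc => ⟨hcc.1.symm, by rw [inter_comm (Metric.ball (c' : X) ρ)]; exact hcc.2⟩⟩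
    ⟨fun c hc => hc.1 rfl⟩
  have hball : ∀ c : T, ∀ v ∈ s, ∀ w ∈ s, v ∈ Metric.ball (c : X) ρ → w ∈ Metric.ball (c : X) ρ →
      dist (f v) (f w) ≤ A := by
    intro c v hv w hw hvc hwc
    refine hf v hv w hw ?_
    have := dist_triangle_right v w (c : X)
    rw [Metric.mem_ball] at hvc hwc
    linarith
  have hwalk : ∀ (c c' : T) (W : G.Walk c c'), ∀ v ∈ s, ∀ w ∈ s, v ∈ Metric.ball (c : X) ρ →
      w ∈ Metric.ball (c' : X) ρ → dist (f v) (f w) ≤ (W.length + 1) * A := by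
    intro c c' W
    induction W with
    | nil =>
      intro v hv w hw hvc hwc
      simpa using hball _ v hv w hw hvc hwc
    | cons hadj W ih =>
      intro v hv w hw hvc hwc
      obtain ⟨-, z, hz, hzc, hzc'⟩ := hadj
      have h1 := hball _ v hv z hz hvc hzc
      have h2 := ih z hz w hw hzc' hwc
      have h3 := dist_triangle (f v) (f z) (f w)
      rw [SimpleGraph.Walk.length_cons]
      push_cast
      linarith
  obtain ⟨c, hcT, hxc⟩ := mem_iUnion₂.1 (hT hx)
  obtain ⟨c', hcT', hyc'⟩ := mem_iUnion₂.1 (hT hy)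
  have hreach : G.Reachable ⟨c, hcT⟩ ⟨c', hcT'⟩ := by
    by_contra hnot
    let U : Set X := ⋃ d ∈ {d : T | G.Reachable ⟨c, hcT⟩ d}, Metric.ball (d : X) ρ
    let V : Set X := ⋃ d ∈ {d : T | ¬ G.Reachable ⟨c, hcT⟩ d}, Metric.ball (d : X) ρ
    obtain ⟨z, hz, hzU, hzV⟩ := hs U V (isOpen_biUnion fun _ _ => Metric.isOpen_ball)
      (isOpen_biUnion fun _ _ => Metric.isOpen_ball)
      (fun z hz => by
        obtain ⟨d, hd, hzd⟩ := mem_iUnion₂.1 (hT hz)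
        by_cases hr : G.Reachable ⟨c, hcT⟩ ⟨d, hd⟩
        · exact Or.inl (mem_biUnion (x := (⟨d, hd⟩ : T)) hr hzd)
        · exact Or.inr (mem_biUnion (x := (⟨d, hd⟩ : T)) hr hzd))
      ⟨x, hx, mem_biUnion (x := (⟨c, hcT⟩ : T)) (SimpleGraph.Reachable.refl _) hxc⟩
      ⟨y, hy, mem_biUnion (x := (⟨c', hcT'⟩ : T)) hnot hyc'⟩
    obtain ⟨d, hd, hzd⟩ := mem_iUnion₂.1 hzU
    obtain ⟨d', hd', hzd'⟩ := mem_iUnion₂.1 hzV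
    have hne : d ≠ d' := by rintro rfl; exact hd' hd
    exact hd' (hd.trans (SimpleGraph.Adj.reachable (G := G) ⟨hne, z, hz, hzd, hzd'⟩))
  obtain ⟨W, hW⟩ := hreach.exists_isPath
  refine (hwalk _ _ W x hx y hy hxc hyc').trans (mul_le_mul_of_nonneg_right ?_ hA)
  have := hW.length_lt
  rw [Fintype.card_coe] at this
  exact_mod_cast this

lemma norm_sub_le_of_segment (h : IsLipschitzDomain 𝒵 Ω) {u : Plane → Plane}
    (hu : ∀ z ∈ Ω, DifferentiableAt ℝ u z) {τ G : ℝ} (hG0 : 0 ≤ G)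
    (hG : ∀ z ∈ Ω, τ ≤ bdryDist Ω z → ‖fderiv ℝ u z‖ ≤ G) {a b : Plane}
    (hab : ∀ z ∈ segment ℝ a b, z ∈ Ω ∧ τ ≤ bdryDist Ω z) :
    ‖u b - u a‖ ≤ 2 * outerRadius 𝒵 * G := by
  have h1 := (convex_segment a b).norm_image_sub_le_of_norm_fderiv_le (𝕜 := ℝ)
    (fun z hz => hu z (hab z hz).1) (fun z hz => hG z (hab z hz).1 (hab z hz).2)
    (left_mem_segment ℝ a b) (right_mem_segment ℝ a b)
  have h2 : ‖b - a‖ ≤ 2 * outerRadius 𝒵 := by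
    have := norm_sub_le b a
    linarith [norm_le_of_mem h (hab a (left_mem_segment ℝ a b)).1,
      norm_le_of_mem h (hab b (right_mem_segment ℝ a b)).1]
  calc ‖u b - u a‖ ≤ G * ‖b - a‖ := h1
    _ ≤ G * (2 * outerRadius 𝒵) := by gcongr
    _ = _ := by ring

/-- Two nearby points at distance at least `τ` from `∂Ω` are joined by at most three segments
(up, across, down) that stay at distance at least `τ / (1 + M)` from `∂Ω`. -/
lemma norm_sub_le_of_dist_le (h : IsLipschitzDomain 𝒵 Ω) {u : Plane → Plane}
    (hu : ∀ z ∈ Ω, DifferentiableAt ℝ u z) {τ ε G : ℝ} (hτ : 0 < τ) (hτr : 2 * τ ≤ 𝒵.r₀)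
    (hε : 2 * ((1 + 𝒵.M) * ε) ≤ 𝒵.r₀) (hG0 : 0 ≤ G)
    (hG : ∀ z ∈ Ω, τ / (1 + 𝒵.M) ≤ bdryDist Ω z → ‖fderiv ℝ u z‖ ≤ G) {a b : Plane}
    (ha : a ∈ Ω) (hb : b ∈ Ω) (hda : τ ≤ bdryDist Ω a) (hdb : τ ≤ bdryDist Ω b)
    (hab : dist b a ≤ ε) :
    ‖u b - u a‖ ≤ 6 * outerRadius 𝒵 * G := by
  have hM : (0 : ℝ) ≤ 𝒵.M := 𝒵.M.2
  have hr := 𝒵.r₀_pos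
  have hR := outerRadius_pos 𝒵
  have hε0 : 0 ≤ ε := dist_nonneg.trans hab
  have hMε : 0 ≤ (𝒵.M : ℝ) * ε := by positivity
  rcases le_or_gt 𝒵.r₀ (bdryDist Ω a) with hfar | hnear
  · refine (norm_sub_le_of_segment h hu hG0 hG (a := a) (b := b) fun z hz => ?_).trans
      (by nlinarith)
    have hza : dist z a ≤ ε := by
      have hsub : segment ℝ a b ⊆ Metric.closedBall a ε :=
        (convex_closedBall a ε).segment_subset (Metric.mem_closedBall_self hε0) hab
      exact hsub hz
    refine ⟨mem_of_dist_lt h ha (by linarith), ?_⟩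
    have h1 := bdryDist_le_add Ω a z
    rw [dist_comm] at h1
    have h2 : τ / (1 + 𝒵.M) ≤ τ := div_le_self hτ.le (by linarith)
    linarith
  · obtain ⟨e, he, hv⟩ := exists_vertical h hnear
    have hdist : ∀ z ∈ Ω, dist z a ≤ ε → τ ≤ bdryDist Ω z → ∀ v : Plane, ∀ t,
        (1 + 𝒵.M) * ‖v‖ ≤ t → t ≤ 𝒵.r₀ → z + v + t • e ∈ Ω ∧
          τ / (1 + 𝒵.M) ≤ bdryDist Ω (z + v + t • e) := by
      intro z hz hza hzd v t h1 h2
      obtain ⟨h3, h4⟩ := hv z hz (by linarith) v t h1 h2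
      refine ⟨h3, ?_⟩
      rw [div_le_iff₀ (by positivity)]
      linarith
    set T := (1 + 𝒵.M) * ε with hT
    have hT0 : 0 ≤ T := by positivity
    have hup : ∀ z ∈ Ω, dist z a ≤ ε → τ ≤ bdryDist Ω z →
        ‖u (z + T • e) - u z‖ ≤ 2 * outerRadius 𝒵 * G := by
      intro z hz hza hzd
      refine norm_sub_le_of_segment h hu hG0 hG fun w hw => ?_
      rw [segment_eq_image'] at hw
      obtain ⟨θ, ⟨hθ0, hθ1⟩, rfl⟩ := hw
      have := hdist z hz hza hzd 0 (θ * T) (by simp; positivity) (by nlinarith)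
      simpa [smul_smul] using this
    have hacross : ‖u (b + T • e) - u (a + T • e)‖ ≤ 2 * outerRadius 𝒵 * G := by
      refine norm_sub_le_of_segment h hu hG0 hG fun w hw => ?_
      rw [segment_eq_image'] at hw
      obtain ⟨θ, ⟨hθ0, hθ1⟩, rfl⟩ := hw
      have hθ : ‖θ • (b - a)‖ ≤ ε := by
        rw [norm_smul, Real.norm_eq_abs, abs_of_nonneg hθ0, ← dist_eq_norm]
        exact (mul_le_of_le_one_left dist_nonneg hθ1).trans hab
      have := hdist a ha (by simpa using hε0) hda (θ • (b - a)) T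
        (mul_le_mul_of_nonneg_left hθ (by positivity)) (by linarith)
      beta_reduce
      rwa [show a + T • e + θ • (b + T • e - (a + T • e)) = a + θ • (b - a) + T • e by
        rw [add_sub_add_right_eq_sub]; abel]
    have h1 := hup a ha (by simpa using hε0) hda
    have h2 := hup b hb hab hdb
    rw [norm_sub_rev] at h2
    calc ‖u b - u a‖ = ‖(u b - u (b + T • e)) + (u (b + T • e) - u (a + T • e)) +
          (u (a + T • e) - u a)‖ := by congr 1; abel
      _ ≤ _ := norm_add₃_le
      _ ≤ _ := by linarith

/-- Points at distance at least `τ` from the boundary are joined inside `Ω` in a quantitative way,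
uniformly over all domains with the same cylinders: the oscillation of `u` between them is bounded
by the supremum of `|∇u|` slightly closer to the boundary. The points of a chain of small steps in
`Ω` are first lifted away from the boundary. -/
lemma exists_norm_sub_le (𝒵 : CylinderCollection) {τ : ℝ} (hτ : 0 < τ) :
    ∃ η C : ℝ, 0 < η ∧ 0 ≤ C ∧ ∀ Ω : Set Plane, IsLipschitzDomain 𝒵 Ω → ∀ u : Plane → Plane,
      (∀ z ∈ Ω, DifferentiableAt ℝ u z) → ∀ G : ℝ, 0 ≤ G →
      (∀ z ∈ Ω, η ≤ bdryDist Ω z → ‖fderiv ℝ u z‖ ≤ G) →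
      ∀ a ∈ Ω, ∀ b ∈ Ω, τ ≤ bdryDist Ω a → τ ≤ bdryDist Ω b → ‖u b - u a‖ ≤ C * G := by
  have hM : (0 : ℝ) ≤ 𝒵.M := 𝒵.M.2
  have hr := 𝒵.r₀_pos
  have hR := outerRadius_pos 𝒵
  set ρ := 𝒵.r₀ / (8 * (1 + 𝒵.M)) with hρdef
  have hρ : 0 < ρ := by positivity
  have hρr : (1 + 𝒵.M) * ρ = 𝒵.r₀ / 8 := by rw [hρdef]; field_simp
  have hρr' : ρ ≤ 𝒵.r₀ / 8 := by nlinarith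
  set τ' := min τ (ρ / (1 + 𝒵.M)) with hτ'def
  have hτ' : 0 < τ' := lt_min hτ (by positivity)
  have hτρ : τ' ≤ ρ / (1 + 𝒵.M) := min_le_right _ _
  have hρM : ρ / (1 + 𝒵.M) ≤ ρ := div_le_self hρ.le (by linarith)
  obtain ⟨T, -, hTfin, hT⟩ :=
    (isCompact_closedBall (0 : Plane) (outerRadius 𝒵)).finite_cover_balls hρ
  lift T to Finset Plane using hTfin
  refine ⟨τ' / (1 + 𝒵.M), (2 + T.card) * (6 * outerRadius 𝒵), by positivity, by positivity, ?_⟩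
  intro Ω h u hu G hG0 hG a ha b hb hda hdb
  have hlift : ∀ w : Plane, ∃ w', w ∈ Ω → w' ∈ Ω ∧ dist w' w ≤ ρ ∧ τ' ≤ bdryDist Ω w' := by
    intro w
    by_cases hw : w ∈ Ω
    · rcases le_or_gt ρ (bdryDist Ω w) with h1 | h1
      · exact ⟨w, fun _ => ⟨hw, by simpa using hρ.le, by linarith⟩⟩
      · obtain ⟨e, he, hv⟩ := exists_vertical h (y := w) (by linarith)
        obtain ⟨h2, h3⟩ := hv w hw (by simpa using hr.le) 0 ρ (by simpa using hρ.le) (by linarith)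
        rw [add_zero, norm_zero, mul_zero, sub_zero] at *
        refine ⟨w + ρ • e, fun _ => ⟨h2, ?_, ?_⟩⟩
        · simp [norm_smul, he, abs_of_pos hρ]
        · refine hτρ.trans ?_
          rw [div_le_iff₀ (by positivity)]
          linarith [bdryDist_nonneg Ω w]
    · exact ⟨w, fun hw' => absurd hw' hw⟩
  choose L hL using hlift
  have hloc : ∀ x ∈ Ω, ∀ y ∈ Ω, τ' ≤ bdryDist Ω x → τ' ≤ bdryDist Ω y → dist x y ≤ 4 * ρ →
      dist (u x) (u y) ≤ 6 * outerRadius 𝒵 * G := by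
    intro x hx y hy hdx hdy hxy
    rw [dist_eq_norm]
    exact norm_sub_le_of_dist_le h hu hτ' (by linarith) (by linarith) hG0 hG hy hx hdy hdx hxy
  have hchain := dist_le_card_mul_of_isPreconnected h.isConnected.isPreconnected T
    (ρ := ρ) (A := 6 * outerRadius 𝒵 * G) (by positivity)
    (fun x hx => hT (by simpa using norm_le_of_mem h hx)) (f := fun w => u (L w))
    (fun x hx y hy hxy => by
      obtain ⟨x1, x2, x3⟩ := hL x hx
      obtain ⟨y1, y2, y3⟩ := hL y hy
      refine hloc _ x1 _ y1 x3 y3 ?_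
      have t1 := dist_triangle (L x) x (L y)
      have t2 := dist_triangle x y (L y)
      rw [dist_comm y] at t2
      linarith) hb ha
  obtain ⟨a1, a2, a3⟩ := hL a ha
  obtain ⟨b1, b2, b3⟩ := hL b hb
  have ea := hloc _ a1 _ ha a3 ((min_le_left _ _).trans hda) (by linarith)
  have eb := hloc _ hb _ b1 ((min_le_left _ _).trans hdb) b3 (by rw [dist_comm]; linarith)
  rw [← dist_eq_norm]
  have t1 := dist_triangle4 (u b) (u (L b)) (u (L a)) (u a)
  linarith

/-! ### Integration along vertical paths -/

lemma norm_sub_le_of_norm_deriv_le_rpow {E : Type*} [NormedAddCommGroup E] [NormedSpace ℝ E]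
    {f f' : ℝ → E} {a b B s : ℝ} (hs : 1 < s) (ha : 0 < a) (hab : a ≤ b)
    (hf : ∀ t ∈ Icc a b, HasDerivAt f (f' t) t) (hB : ∀ t ∈ Icc a b, ‖f' t‖ ≤ B * t ^ (-s)) :
    ‖f b - f a‖ ≤ B / (s - 1) * (a ^ (1 - s) - b ^ (1 - s)) := by
  have hs1 : 0 < s - 1 := by linarith
  have hg : ∀ t ∈ Icc a b, HasDerivAt (fun t => B / (s - 1) * (a ^ (1 - s) - t ^ (1 - s)))
      (B * t ^ (-s)) t := by
    intro t ht
    have h1 := ((Real.hasDerivAt_rpow_const (x := t) (p := 1 - s)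
      (Or.inl (ha.trans_le ht.1).ne')).const_sub (a ^ (1 - s))).const_mul (B / (s - 1))
    refine h1.congr_deriv ?_
    rw [show 1 - s - 1 = -s by ring]
    field_simp
    ring
  refine image_norm_le_of_norm_deriv_right_le_deriv_boundary' (a := a) (b := b)
    (f := fun t => f t - f a) (f' := f') (B := fun t => B / (s - 1) * (a ^ (1 - s) - t ^ (1 - s)))
    (B' := fun t => B * t ^ (-s)) ?_ ?_ (by simp) ?_ ?_ ?_ (right_mem_Icc.2 hab)
  · exact fun t ht => ((hf t ht).sub_const _).continuousAt.continuousWithinAt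
  · exact fun t ht => ((hf t (Ico_subset_Icc_self ht)).sub_const _).hasDerivWithinAt
  · exact fun t ht => (hg t ht).continuousAt.continuousWithinAt
  · exact fun t ht => (hg t (Ico_subset_Icc_self ht)).hasDerivWithinAt
  · exact fun t ht => hB t (Ico_subset_Icc_self ht)

/-- If `|f'(t)| ≤ min(A, B t^{-1/p})` with `0 < p < 1`, the increment of `f` is at most a multiple
of `B^p A^{1-p}`, the value obtained by splitting at the point `(B / A)^p` where the two bounds
agree. -/
lemma norm_sub_le_of_norm_deriv_le_min {E : Type*} [NormedAddCommGroup E] [NormedSpace ℝ E]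
    {f f' : ℝ → E} {a b A B p : ℝ} (hp0 : 0 < p) (hp1 : p < 1) (ha : 0 < a) (hab : a ≤ b)
    (hA : 0 ≤ A) (hB0 : 0 ≤ B) (hf : ∀ t ∈ Icc a b, HasDerivAt f (f' t) t)
    (hfA : ∀ t ∈ Icc a b, ‖f' t‖ ≤ A) (hfB : ∀ t ∈ Icc a b, ‖f' t‖ ≤ B * t ^ (-(1 / p))) :
    ‖f b - f a‖ ≤ 1 / (1 - p) * (B ^ p * A ^ (1 - p)) := by
  have hs : 1 < 1 / p := by rw [lt_div_iff₀ hp0]; linarith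
  have hnear : ∀ m ∈ Icc a b, ‖f m - f a‖ ≤ A * (m - a) := by
    intro m hm
    refine norm_image_sub_le_of_norm_deriv_right_le_segment (a := a) (b := b) (f' := f')
      ?_ ?_ ?_ m hm
    · exact fun t ht => (hf t ht).continuousAt.continuousWithinAt
    · exact fun t ht => (hf t (Ico_subset_Icc_self ht)).hasDerivWithinAt
    · exact fun t ht => hfA t (Ico_subset_Icc_self ht)
  have hfar : ∀ m ∈ Icc a b, ‖f b - f m‖ ≤
      B / (1 / p - 1) * (m ^ (1 - 1 / p) - b ^ (1 - 1 / p)) := by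
    intro m hm
    exact norm_sub_le_of_norm_deriv_le_rpow hs (ha.trans_le hm.1) hm.2
      (fun t ht => hf t ⟨hm.1.trans ht.1, ht.2⟩) (fun t ht => hfB t ⟨hm.1.trans ht.1, ht.2⟩)
  have h1p : 0 < 1 - p := by linarith
  have hRHS : 0 ≤ 1 / (1 - p) * (B ^ p * A ^ (1 - p)) := by positivity
  rcases hA.eq_or_lt with rfl | hA
  · have := hnear b (right_mem_Icc.2 hab)
    rw [zero_mul] at this
    exact this.trans hRHS
  rcases hB0.eq_or_lt with rfl | hB0
  · have := hfar a (left_mem_Icc.2 hab)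
    rw [zero_div, zero_mul] at this
    exact this.trans hRHS
  set t₀ := (B / A) ^ p with ht₀
  have ht₀pos : 0 < t₀ := by positivity
  have hAt : A * t₀ = B ^ p * A ^ (1 - p) := by
    rw [ht₀, Real.div_rpow hB0.le hA.le, Real.rpow_sub hA, Real.rpow_one]
    field_simp
  have hBt : B * t₀ ^ (1 - 1 / p) = B ^ p * A ^ (1 - p) := by
    rw [ht₀, ← Real.rpow_mul (by positivity), show p * (1 - 1 / p) = -(1 - p) by field_simp; ring,
      Real.rpow_neg (by positivity), Real.div_rpow hB0.le hA.le, inv_div, Real.rpow_sub hB0,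
      Real.rpow_one]
    field_simp
  set m := max a (min t₀ b) with hm
  have hmI : m ∈ Icc a b := ⟨le_max_left _ _, max_le hab (min_le_right _ _)⟩
  have e1 : ‖f m - f a‖ ≤ B ^ p * A ^ (1 - p) := by
    refine (hnear m hmI).trans (le_trans ?_ hAt.le)
    gcongr
    rcases le_total a (min t₀ b) with h | h
    · rw [hm, max_eq_right h]; linarith [min_le_left t₀ b]
    · rw [hm, max_eq_left h]; linarith
  have e2 : ‖f b - f m‖ ≤ p / (1 - p) * (B ^ p * A ^ (1 - p)) := by
    refine (hfar m hmI).trans ?_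
    rw [← hBt, show p / (1 - p) * (B * t₀ ^ (1 - 1 / p)) = B / (1 / p - 1) * t₀ ^ (1 - 1 / p) by
      field_simp]
    have hc : 0 ≤ B / (1 / p - 1) := div_nonneg hB0.le (by linarith)
    refine mul_le_mul_of_nonneg_left ?_ hc
    rcases le_total t₀ b with h | h
    · have hmt : t₀ ≤ m := by rw [hm, min_eq_left h]; exact le_max_right _ _
      have h1 := Real.rpow_le_rpow_of_nonpos ht₀pos hmt (show 1 - 1 / p ≤ 0 by linarith)
      have h2 : 0 ≤ b ^ (1 - 1 / p) := Real.rpow_nonneg (ha.le.trans hab) _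
      linarith
    · have hmb : m = b := by rw [hm, min_eq_right h, max_eq_right hab]
      rw [hmb, sub_self]
      positivity
  calc ‖f b - f a‖ = ‖(f b - f m) + (f m - f a)‖ := by rw [sub_add_sub_cancel]
    _ ≤ _ := norm_add_le _ _
    _ ≤ p / (1 - p) * (B ^ p * A ^ (1 - p)) + B ^ p * A ^ (1 - p) := add_le_add e2 e1
    _ = _ := by field_simp; ring

/-- Control of `|u|` in the approach region of `x` by its size at an interior point, the decay bound
`|∇u| ≤ B d^{-1/p}`, and a bound `A` for `|∇u|` in a wider approach region of `x`. -/
lemma exists_norm_le_of_mem_approachRegion (𝒵 : CylinderCollection) {α β p δ : ℝ} (hα : 0 < α)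
    (hβ : 1 + β = (1 + 𝒵.M) * (1 + α)) (hp0 : 0 < p) (hp1 : p < 1) (hδ : 0 < δ) :
    ∃ C : ℝ, 0 ≤ C ∧ ∀ Ω : Set Plane, IsLipschitzDomain 𝒵 Ω → ∀ u : Plane → Plane,
      (∀ z ∈ Ω, DifferentiableAt ℝ u z) → ∀ B : ℝ, 0 ≤ B →
      (∀ z ∈ Ω, ‖fderiv ℝ u z‖ ≤ B * bdryDist Ω z ^ (-(1 / p))) →
      ∀ k ∈ Ω, δ ≤ bdryDist Ω k → ∀ x : Plane, ∀ A : ℝ, 0 ≤ A →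
      (∀ z ∈ approachRegion Ω β x, ‖fderiv ℝ u z‖ ≤ A) →
      ∀ y ∈ approachRegion Ω α x, ‖u y‖ ≤ ‖u k‖ + C * (B + B ^ p * A ^ (1 - p)) := by
  have hM : (0 : ℝ) ≤ 𝒵.M := 𝒵.M.2
  have hr := 𝒵.r₀_pos
  have h1p : 0 < 1 - p := by linarith
  obtain ⟨η, C, hη, hC, hosc⟩ := exists_norm_sub_le 𝒵
    (τ := min δ (𝒵.r₀ / (1 + 𝒵.M))) (lt_min hδ (by positivity))
  refine ⟨C * η ^ (-(1 / p)) + (1 + 𝒵.M) / (1 - p), by positivity, ?_⟩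
  intro Ω h u hu B hB0 hB k hk hdk x A hA0 hA y hy
  have hnp : -(1 / p) ≤ 0 := neg_nonpos.2 (by positivity)
  have hint : ∀ w ∈ Ω, 𝒵.r₀ / (1 + 𝒵.M) ≤ bdryDist Ω w →
      ‖u w‖ ≤ ‖u k‖ + C * η ^ (-(1 / p)) * B := by
    intro w hw hdw
    have h1 := hosc Ω h u hu (B * η ^ (-(1 / p))) (by positivity)
      (fun z hz hdz => (hB z hz).trans
        (mul_le_mul_of_nonneg_left (Real.rpow_le_rpow_of_nonpos hη hdz hnp) hB0))
      k hk w hw ((min_le_left _ _).trans hdk) ((min_le_right _ _).trans hdw)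
    have h2 := norm_add_le (u k) (u w - u k)
    rw [add_sub_cancel] at h2
    linarith
  have hX : 0 ≤ B ^ p * A ^ (1 - p) := by positivity
  have hc1 : 0 ≤ C * η ^ (-(1 / p)) := by positivity
  have hc2 : 0 ≤ (1 + 𝒵.M) / (1 - p) := by positivity
  have hfinal : ‖u k‖ + C * η ^ (-(1 / p)) * B + (1 + 𝒵.M) / (1 - p) * (B ^ p * A ^ (1 - p)) ≤
      ‖u k‖ + (C * η ^ (-(1 / p)) + (1 + 𝒵.M) / (1 - p)) * (B + B ^ p * A ^ (1 - p)) := by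
    have := mul_nonneg hc1 hX
    have := mul_nonneg hc2 hB0
    linarith
  refine le_trans ?_ hfinal
  rcases le_or_gt 𝒵.r₀ (bdryDist Ω y) with hfar | hnear
  · have h1 := hint y hy.1 ((div_le_self hr.le (by linarith)).trans hfar)
    have := mul_nonneg hc2 hX
    linarith
  · obtain ⟨e, he, hv⟩ := exists_vertical h hnear
    have hd := bdryDist_pos h hy.1
    set d := bdryDist Ω y with hddef
    -- The path is parametrized by `t = d(y) + ` the distance travelled.
    have hpath : ∀ t ∈ Icc d (d + 𝒵.r₀), y + (t - d) • e ∈ Ω ∧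
        t ≤ (1 + 𝒵.M) * bdryDist Ω (y + (t - d) • e) := by
      intro t ht
      have := hv y hy.1 (by simpa using hr.le) 0 (t - d) (by simpa using ht.1)
        (by linarith [ht.2])
      rw [add_zero, norm_zero, mul_zero, sub_zero, ← hddef, add_sub_cancel] at this
      exact this
    have hderiv : ∀ t ∈ Icc d (d + 𝒵.r₀), HasDerivAt (fun t => u (y + (t - d) • e))
        (fderiv ℝ u (y + (t - d) • e) e) t := by
      intro t ht
      have h1 : HasDerivAt (fun t : ℝ => y + (t - d) • e) e t := by
        simpa using (((hasDerivAt_id t).sub_const d).smul_const e).const_add y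
      exact (hu _ (hpath t ht).1).hasFDerivAt.comp_hasDerivAt t h1
    have hle : ∀ t, ‖fderiv ℝ u (y + (t - d) • e) e‖ ≤ ‖fderiv ℝ u (y + (t - d) • e)‖ := by
      intro t
      simpa [he] using (fderiv ℝ u (y + (t - d) • e)).le_opNorm e
    have hinc := norm_sub_le_of_norm_deriv_le_min (A := A) (B := B * (1 + 𝒵.M) ^ (1 / p)) hp0 hp1 hd
      (by linarith) hA0 (by positivity) hderiv
      (fun t ht => by
        refine (hle t).trans (hA _ ⟨(hpath t ht).1, ?_⟩)
        have h1 := dist_triangle x y (y + (t - d) • e)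
        have h2 : dist y (y + (t - d) • e) = t - d := by
          simp [norm_smul, he, abs_of_nonneg (sub_nonneg.2 ht.1)]
        have h3 := hy.2
        rw [← hddef] at h3
        have h4 : (1 + α) * t ≤ (1 + α) * ((1 + 𝒵.M) * bdryDist Ω (y + (t - d) • e)) :=
          mul_le_mul_of_nonneg_left (hpath t ht).2 (by positivity)
        rw [hβ]
        nlinarith [ht.1])
      (fun t ht => by
        refine (hle t).trans ((hB _ (hpath t ht).1).trans ?_)
        have ht0 : 0 < t := hd.trans_le ht.1
        have h1 : t / (1 + 𝒵.M) ≤ bdryDist Ω (y + (t - d) • e) := by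
          rw [div_le_iff₀ (by positivity)]
          linarith [(hpath t ht).2]
        have h2 := Real.rpow_le_rpow_of_nonpos (by positivity) h1 hnp
        rw [Real.div_rpow ht0.le (by positivity), Real.rpow_neg (by positivity : (0:ℝ) ≤ 1 + 𝒵.M),
          div_inv_eq_mul] at h2
        calc B * bdryDist Ω (y + (t - d) • e) ^ (-(1 / p))
            ≤ B * (t ^ (-(1 / p)) * (1 + 𝒵.M) ^ (1 / p)) := by gcongr
          _ = _ := by ring)
    simp only [add_sub_cancel_left, sub_self, zero_smul, add_zero] at hinc
    rw [Real.mul_rpow hB0 (by positivity), ← Real.rpow_mul (by positivity),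
      one_div_mul_cancel hp0.ne', Real.rpow_one, norm_sub_rev] at hinc
    have htop := hpath (d + 𝒵.r₀) ⟨by linarith, le_rfl⟩
    rw [add_sub_cancel_left] at htop
    have h1 := hint _ htop.1 (by rw [div_le_iff₀ (by positivity)]; linarith)
    have h2 := norm_add_le (u (y + 𝒵.r₀ • e)) (u y - u (y + 𝒵.r₀ • e))
    rw [add_sub_cancel] at h2
    have h3 : 1 / (1 - p) * (B ^ p * (1 + 𝒵.M) * A ^ (1 - p)) =
        (1 + 𝒵.M) / (1 - p) * (B ^ p * A ^ (1 - p)) := by ring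
    linarith

/-! ### The gradient and the derivative -/

lemma norm_fderiv_le_gradient2 {u : Plane → Plane} {z : Plane} (hu : DifferentiableAt ℝ u z) :
    ‖fderiv ℝ u z‖ ≤ 4 * ‖gradient2 u z‖ := by
  have hentry : ∀ j b : Fin 2, |fderiv ℝ u z (EuclideanSpace.single j 1) b| ≤ ‖gradient2 u z‖ := by
    intro j b
    have h1 : fderiv ℝ (fun y => u y b) z = (EuclideanSpace.proj b : Plane →L[ℝ] ℝ).comp
        (fderiv ℝ u z) :=
      ((EuclideanSpace.proj b : Plane →L[ℝ] ℝ).hasFDerivAt.comp z hu.hasFDerivAt).fderiv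
    have h2 := PiLp.norm_apply_le (gradient2 u z) (j, b)
    simpa [gradient2, partialDeriv, h1] using h2
  refine ContinuousLinearMap.opNorm_le_bound _ (by positivity) fun w => ?_
  have hw : w = w 0 • EuclideanSpace.single 0 1 + w 1 • EuclideanSpace.single 1 1 := by
    ext i; fin_cases i <;> simp
  have hcol : ∀ b : Fin 2, |fderiv ℝ u z w b| ≤ 2 * ‖gradient2 u z‖ * ‖w‖ := by
    intro b
    have h0 : |w 0 * fderiv ℝ u z (EuclideanSpace.single 0 1) b| ≤ ‖w‖ * ‖gradient2 u z‖ := by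
      rw [abs_mul]
      exact mul_le_mul (abs_apply_le w 0) (hentry 0 b) (abs_nonneg _) (norm_nonneg _)
    have h1 : |w 1 * fderiv ℝ u z (EuclideanSpace.single 1 1) b| ≤ ‖w‖ * ‖gradient2 u z‖ := by
      rw [abs_mul]
      exact mul_le_mul (abs_apply_le w 1) (hentry 1 b) (abs_nonneg _) (norm_nonneg _)
    conv_lhs => rw [hw]
    rw [map_add, map_smul, map_smul, PiLp.add_apply, PiLp.smul_apply, PiLp.smul_apply]
    refine (abs_add_le _ _).trans ?_
    simp only [smul_eq_mul]
    linarith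
  refine (norm_le_abs_add_abs _).trans ?_
  linarith [hcol 0, hcol 1]

/-! ### Integration over the boundary -/

lemma ennreal_add_rpow_le {r : ℝ} (hr : 0 ≤ r) (x y : ℝ≥0∞) :
    (x + y) ^ r ≤ 2 ^ r * (x ^ r + y ^ r) := by
  have h1 : x + y ≤ 2 * max x y := by
    rw [two_mul]
    exact add_le_add (le_max_left _ _) (le_max_right _ _)
  calc (x + y) ^ r ≤ (2 * max x y) ^ r := ENNReal.rpow_le_rpow h1 hr
    _ = 2 ^ r * max x y ^ r := ENNReal.mul_rpow_of_nonneg _ _ hr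
    _ ≤ _ := by
      gcongr
      rcases le_total x y with h | h
      · rw [max_eq_right h]; exact le_add_self
      · rw [max_eq_left h]; exact le_self_add

/-- The exponent `q` with `1 / q = 1 / p - 1` is the one for which `(N^{1-p})^q = N^p`, so a bound
of `F` by a constant plus `I N^{1-p}` with `∫ N^p ≲ I` gives a bound for the `L^q` norm of `F`. -/
lemma lintegral_rpow_le_of_le_rpow {X : Type*} [MeasurableSpace X] {μ : Measure X} {p q : ℝ}
    (hp0 : 0 < p) (hp1 : p < 1) (hq : 1 / q = 1 / p - 1) {F N : X → ℝ≥0∞}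
    (hN : Measurable N) {a I D₂ D₃ D₄ : ℝ≥0∞}
    (hF : ∀ᵐ x ∂μ, F x ≤ a + D₂ * I * N x ^ (1 - p)) (hI : ∫⁻ x, N x ^ p ∂μ ≤ D₃ * I)
    (hμ : μ univ ≤ D₄) :
    (∫⁻ x, F x ^ q ∂μ) ^ (1 / q) ≤
      2 ^ (1 / q) * 2 * (D₄ ^ (1 / q) * a + D₂ * D₃ ^ (1 / q) * I ^ (1 / p)) := by
  have hq0 : 0 < 1 / q := by
    rw [hq, sub_pos, lt_div_iff₀ hp0]
    linarith
  have hqpos : 0 < q := one_div_pos.1 hq0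
  have hexp : (1 - p) * q = p := by
    field_simp at hq
    linarith
  have h1 : ∫⁻ x, F x ^ q ∂μ ≤ 2 ^ q * (a ^ q * D₄ + (D₂ * I) ^ q * (D₃ * I)) := by
    calc ∫⁻ x, F x ^ q ∂μ ≤ ∫⁻ x, 2 ^ q * (a ^ q + (D₂ * I) ^ q * N x ^ p) ∂μ := by
          refine lintegral_mono_ae (hF.mono fun x hx => ?_)
          refine (ENNReal.rpow_le_rpow hx hqpos.le).trans
            ((ennreal_add_rpow_le hqpos.le _ _).trans_eq ?_)
          rw [ENNReal.mul_rpow_of_nonneg (D₂ * I) _ hqpos.le, ← ENNReal.rpow_mul, hexp]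
      _ = 2 ^ q * (a ^ q * μ univ + (D₂ * I) ^ q * ∫⁻ x, N x ^ p ∂μ) := by
          rw [lintegral_const_mul _ (by fun_prop), lintegral_add_left (by fun_prop),
            lintegral_const, lintegral_const_mul _ (by fun_prop)]
      _ ≤ _ := by gcongr
  have hqq : q * (1 / q) = 1 := mul_one_div_cancel hqpos.ne'
  calc (∫⁻ x, F x ^ q ∂μ) ^ (1 / q)
      ≤ (2 ^ q * (a ^ q * D₄ + (D₂ * I) ^ q * (D₃ * I))) ^ (1 / q) :=
        ENNReal.rpow_le_rpow h1 hq0.le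
    _ = 2 * (a ^ q * D₄ + (D₂ * I) ^ q * (D₃ * I)) ^ (1 / q) := by
        rw [ENNReal.mul_rpow_of_nonneg _ _ hq0.le, ← ENNReal.rpow_mul, hqq, ENNReal.rpow_one]
    _ ≤ 2 * (2 ^ (1 / q) *
          ((a ^ q * D₄) ^ (1 / q) + ((D₂ * I) ^ q * (D₃ * I)) ^ (1 / q))) := by
        gcongr
        exact ennreal_add_rpow_le hq0.le _ _
    _ = _ := by
        rw [ENNReal.mul_rpow_of_nonneg _ _ hq0.le, ENNReal.mul_rpow_of_nonneg _ _ hq0.le,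
          ENNReal.mul_rpow_of_nonneg _ _ hq0.le, ← ENNReal.rpow_mul, ← ENNReal.rpow_mul, hqq,
          ENNReal.rpow_one, ENNReal.rpow_one, show 1 / p = 1 + 1 / q by linarith,
          ENNReal.rpow_add_of_nonneg _ _ zero_le_one hq0.le, ENNReal.rpow_one]
        ring

/-- The gradient decays like `d^{-1/p}` away from the boundary when its maximal function is
in `L^p`. -/
lemma norm_fderiv_le_bdryDist_rpow (h : IsLipschitzDomain 𝒵 Ω) {α p : ℝ} (hα : 0 < α)
    (hp : 0 < p) {u : Plane → Plane}
    (hI : ∫⁻ x, nontan Ω α (gradient2 u) x ^ p ∂surfaceMeasure Ω ≠ ⊤) {z : Plane} (hz : z ∈ Ω)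
    (hu : DifferentiableAt ℝ u z) :
    ‖fderiv ℝ u z‖ ≤ 4 * (lowerConst 𝒵 * min α 1) ^ (-(1 / p)) *
      (∫⁻ x, nontan Ω α (gradient2 u) x ^ p ∂surfaceMeasure Ω).toReal ^ (1 / p) *
      bdryDist Ω z ^ (-(1 / p)) := by
  have hκ : 0 < lowerConst 𝒵 * min α 1 := mul_pos (lowerConst_pos 𝒵) (lt_min hα one_pos)
  have hd := bdryDist_pos h hz
  set I := ∫⁻ x, nontan Ω α (gradient2 u) x ^ p ∂surfaceMeasure Ω
  have h1 := ENNReal.toReal_mono hI (enorm_rpow_mul_bdryDist_le h hα hp (gradient2 u) hz)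
  rw [ENNReal.toReal_mul, ← ENNReal.toReal_rpow, toReal_enorm, ← mul_assoc,
    ENNReal.toReal_ofReal (by positivity), ← le_div_iff₀ (by positivity)] at h1
  have h2 := Real.rpow_le_rpow (by positivity) h1 (show 0 ≤ 1 / p by positivity)
  rw [← Real.rpow_mul (norm_nonneg _), mul_one_div_cancel hp.ne', Real.rpow_one,
    Real.div_rpow ENNReal.toReal_nonneg (by positivity), Real.mul_rpow hκ.le hd.le] at h2
  refine (norm_fderiv_le_gradient2 hu).trans
    ((mul_le_mul_of_nonneg_left h2 (by norm_num)).trans_eq ?_)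
  rw [Real.rpow_neg hκ.le, Real.rpow_neg hd.le]
  field_simp

/-- The main pointwise estimate: `u* ≤ |u(k)| + C ‖(∇u)*‖_p + C ‖(∇u)*‖_p^p ((∇u)*)^{1-p}` almost
everywhere on the boundary, the last maximal function being taken with a wider aperture `β`. -/
lemma exists_nontan_le (𝒵 : CylinderCollection) {α β p δ : ℝ} (hα : 0 < α) (hβ0 : 0 < β)
    (hβ : 1 + β = (1 + 𝒵.M) * (1 + α)) (hp0 : 0 < p) (hp1 : p < 1) (hδ : 0 < δ) :
    ∃ D₁ D₂ : ℝ≥0, ∀ Ω : Set Plane, IsLipschitzDomain 𝒵 Ω → ∀ u : Plane → Plane,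
      (∀ z ∈ Ω, DifferentiableAt ℝ u z) →
      ∫⁻ x, nontan Ω α (gradient2 u) x ^ p ∂surfaceMeasure Ω ≠ ⊤ →
      ∀ k ∈ Ω, δ ≤ bdryDist Ω k → ∀ᵐ x ∂surfaceMeasure Ω,
      nontan Ω α u x ≤ (‖u k‖ₑ +
        D₁ * (∫⁻ x, nontan Ω α (gradient2 u) x ^ p ∂surfaceMeasure Ω) ^ (1 / p)) +
        D₂ * (∫⁻ x, nontan Ω α (gradient2 u) x ^ p ∂surfaceMeasure Ω) *
          nontan Ω β (gradient2 u) x ^ (1 - p) := by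
  obtain ⟨C, hC, hmain⟩ := exists_norm_le_of_mem_approachRegion 𝒵 hα hβ hp0 hp1 hδ
  have hκ : 0 < lowerConst 𝒵 * min α 1 := mul_pos (lowerConst_pos 𝒵) (lt_min hα one_pos)
  have h1p : 0 < 1 - p := by linarith
  set c := 4 * (lowerConst 𝒵 * min α 1) ^ (-(1 / p)) with hc
  have hc0 : 0 ≤ c := by positivity
  refine ⟨(C * c).toNNReal, (C * c ^ p * 4 ^ (1 - p)).toNNReal, ?_⟩
  intro Ω h u hu hI k hk hdk
  have hfin : ∀ᵐ x ∂surfaceMeasure Ω, nontan Ω β (gradient2 u) x ≠ ⊤ := by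
    have h1 : ∫⁻ x, nontan Ω β (gradient2 u) x ^ p ∂surfaceMeasure Ω ≠ ⊤ :=
      ne_top_of_le_ne_top (ENNReal.mul_ne_top ENNReal.ofReal_ne_top hI)
        (lintegral_nontan_rpow_le h hα hβ0 hp0 _)
    refine (ae_lt_top ((measurable_nontan Ω β _).pow_const p) h1).mono fun x hx htop => ?_
    rw [htop, ENNReal.top_rpow_of_pos hp0] at hx
    exact lt_irrefl _ hx
  filter_upwards [hfin] with x hx
  set I := ∫⁻ x, nontan Ω α (gradient2 u) x ^ p ∂surfaceMeasure Ω
  set n := nontan Ω β (gradient2 u) x with hn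
  have hB0 : 0 ≤ c * I.toReal ^ (1 / p) := by positivity
  have hkey := hmain Ω h u hu (c * I.toReal ^ (1 / p)) hB0
    (fun z hz => norm_fderiv_le_bdryDist_rpow h hα hp0 hI hz (hu z hz)) k hk hdk x
    (4 * n.toReal) (by positivity)
    (fun z hz => by
      refine (norm_fderiv_le_gradient2 (hu z hz.1)).trans ?_
      gcongr
      rw [← toReal_enorm]
      exact ENNReal.toReal_mono hx (enorm_le_nontan hz.1 hz.2))
  refine iSup₂_le fun y hy => ?_
  have hBp : (c * I.toReal ^ (1 / p)) ^ p = c ^ p * I.toReal := by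
    rw [Real.mul_rpow hc0 (by positivity), ← Real.rpow_mul ENNReal.toReal_nonneg,
      one_div_mul_cancel hp0.ne', Real.rpow_one]
  have hAp : (4 * n.toReal) ^ (1 - p) = 4 ^ (1 - p) * n.toReal ^ (1 - p) :=
    Real.mul_rpow (by norm_num) ENNReal.toReal_nonneg
  have hy' := hkey y hy
  rw [hBp, hAp] at hy'
  have hsplit : ‖u k‖ + C * (c * I.toReal ^ (1 / p) +
      c ^ p * I.toReal * (4 ^ (1 - p) * n.toReal ^ (1 - p))) =
      ‖u k‖ + C * c * I.toReal ^ (1 / p) +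
        C * c ^ p * 4 ^ (1 - p) * I.toReal * n.toReal ^ (1 - p) := by ring
  rw [hsplit] at hy'
  rw [← ofReal_norm]
  refine (ENNReal.ofReal_le_ofReal hy').trans_eq ?_
  rw [ENNReal.ofReal_add (by positivity) (by positivity),
    ENNReal.ofReal_add (by positivity) (by positivity), ofReal_norm,
    ENNReal.ofReal_mul (p := C * c) (by positivity),
    ENNReal.ofReal_mul (p := C * c ^ p * 4 ^ (1 - p) * I.toReal) (by positivity),
    ENNReal.ofReal_mul (p := C * c ^ p * 4 ^ (1 - p)) (by positivity),
    ENNReal.ofReal_toReal hI, ENNReal.toReal_rpow, ENNReal.toReal_rpow,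
    ENNReal.ofReal_toReal (ENNReal.rpow_ne_top_of_nonneg (by positivity) hI),
    ENNReal.ofReal_toReal (ENNReal.rpow_ne_top_of_nonneg h1p.le hx)]
  rfl

end LipschitzPlane

theorem mainTheorem8 (𝒵 : CylinderCollection) (α : ℝ) (hα : 0 < α)
    (p q : ℝ) (hp0 : 0 < p) (hp1 : p < 1) (hq : 1 / q = 1 / p - 1)
    (K : Set Plane) (hK : IsCompact K) (hKne : K.Nonempty) (δ : ℝ) (hδ : 0 < δ) :
    ∃ C : ℝ≥0, ∀ Ω : Set Plane, IsLipschitzDomain 𝒵 Ω → K ⊆ Ω →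
      (∀ x ∈ K, δ ≤ bdryDist Ω x) →
      ∀ mu lam s : ℝ, LameElliptic mu lam s →
      ∀ u : Plane → Plane, IsLameSolution mu lam s Ω u →
        MemLp (nontan Ω α (gradient2 u)) (ENNReal.ofReal p) (surfaceMeasure Ω) →
        eLpNorm (nontan Ω α u) (ENNReal.ofReal q) (surfaceMeasure Ω) ≤
          C * (eLpNorm (nontan Ω α (gradient2 u)) (ENNReal.ofReal p) (surfaceMeasure Ω) +
            ENNReal.ofReal (𝒵.r₀ ^ (1 / p - 1)) * ⨆ x ∈ K, ‖u x‖ₑ) := by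
  have hq0 : 0 < 1 / q := by
    rw [hq, sub_pos, lt_div_iff₀ hp0]
    linarith
  have hqpos : 0 < q := one_div_pos.1 hq0
  obtain ⟨k, hk⟩ := hKne
  -- The wider aperture absorbs the slope of the boundary along vertical paths.
  obtain ⟨β, hβ⟩ : ∃ β : ℝ, 1 + β = (1 + 𝒵.M) * (1 + α) := ⟨(1 + 𝒵.M) * (1 + α) - 1, by ring⟩
  have hβ0 : 0 < β := by nlinarith [𝒵.M.2]
  obtain ⟨D₁, D₂, hD⟩ := LipschitzPlane.exists_nontan_le 𝒵 hα hβ0 hβ hp0 hp1 hδ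
  set D₃ := ENNReal.ofReal (LipschitzPlane.apertureConst 𝒵 α β)
  set D₄ := ENNReal.ofReal (2 * 𝒵.N * (1 + 𝒵.M) * LipschitzPlane.outerRadius 𝒵)
  set R := ENNReal.ofReal (𝒵.r₀ ^ (1 / p - 1)) with hRdef
  have hR0 : R ≠ 0 := by
    rw [hRdef, Ne, ENNReal.ofReal_eq_zero, not_le]
    exact Real.rpow_pos_of_pos 𝒵.r₀_pos _
  have hRtop : R ≠ ⊤ := ENNReal.ofReal_ne_top
  have hD₃ : D₃ ^ (1 / q) ≠ ⊤ := ENNReal.rpow_ne_top_of_nonneg hq0.le ENNReal.ofReal_ne_top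
  have hD₄ : D₄ ^ (1 / q) ≠ ⊤ := ENNReal.rpow_ne_top_of_nonneg hq0.le ENNReal.ofReal_ne_top
  set C : ℝ≥0∞ := 2 ^ (1 / q) * 2 *
    (D₄ ^ (1 / q) * R⁻¹ + D₄ ^ (1 / q) * D₁ + D₂ * D₃ ^ (1 / q)) with hC
  have hCtop : C ≠ ⊤ := by
    refine ENNReal.mul_ne_top (ENNReal.mul_ne_top
      (ENNReal.rpow_ne_top_of_nonneg hq0.le ENNReal.ofNat_ne_top) ENNReal.ofNat_ne_top) ?_
    exact ENNReal.add_ne_top.2 ⟨ENNReal.add_ne_top.2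
      ⟨ENNReal.mul_ne_top hD₄ (ENNReal.inv_ne_top.2 hR0),
        ENNReal.mul_ne_top hD₄ ENNReal.coe_ne_top⟩, ENNReal.mul_ne_top ENNReal.coe_ne_top hD₃⟩
  refine ⟨C.toNNReal, ?_⟩
  intro Ω h hKΩ hKδ mu lam s _ u hu hmem
  rw [ENNReal.coe_toNNReal hCtop]
  have hdiff : ∀ z ∈ Ω, DifferentiableAt ℝ u z := fun z hz =>
    (hu.contDiffOn.contDiffAt (h.isOpen.mem_nhds hz)).differentiableAt (by norm_num)
  have hnorm : ∀ r : ℝ, 0 < r → ∀ F : Plane → ℝ≥0∞,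
      eLpNorm F (ENNReal.ofReal r) (surfaceMeasure Ω) =
        (∫⁻ x, F x ^ r ∂surfaceMeasure Ω) ^ (1 / r) := fun r hr F => by
    rw [eLpNorm_eq_lintegral_rpow_enorm_toReal (by simpa using hr) ENNReal.ofReal_ne_top,
      ENNReal.toReal_ofReal hr.le]
    simp only [enorm_eq_self]
  have hlt := hmem.2
  rw [hnorm p hp0] at hlt ⊢
  rw [hnorm q hqpos]
  set I := ∫⁻ x, nontan Ω α (gradient2 u) x ^ p ∂surfaceMeasure Ω
  have hI : I ≠ ⊤ := fun htop => by
    rw [htop, ENNReal.top_rpow_of_pos (by positivity)] at hlt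
    exact lt_irrefl _ hlt
  have hfin := LipschitzPlane.lintegral_rpow_le_of_le_rpow hp0 hp1 hq
    (LipschitzPlane.measurable_nontan Ω β (gradient2 u))
    (hD Ω h u hdiff hI k (hKΩ hk) (hKδ k hk))
    (LipschitzPlane.lintegral_nontan_rpow_le h hα hβ0 hp0 (gradient2 u))
    (LipschitzPlane.surfaceMeasure_univ_le h)
  refine hfin.trans ?_
  set S := ⨆ x ∈ K, ‖u x‖ₑ
  have hkS : ‖u k‖ₑ ≤ S := le_iSup₂_of_le k hk le_rfl
  set J := I ^ (1 / p)
  have hSR : S = R⁻¹ * (R * S) := by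
    rw [← mul_assoc, ENNReal.inv_mul_cancel hR0 hRtop, one_mul]
  have hle1 : R * S ≤ J + R * S := le_add_self
  have hle2 : J ≤ J + R * S := le_self_add
  calc 2 ^ (1 / q) * 2 * (D₄ ^ (1 / q) * (‖u k‖ₑ + D₁ * J) + D₂ * D₃ ^ (1 / q) * J)
      ≤ 2 ^ (1 / q) * 2 * (D₄ ^ (1 / q) * (R⁻¹ * (J + R * S) + D₁ * (J + R * S)) +
          D₂ * D₃ ^ (1 / q) * (J + R * S)) := by
        gcongr
        exact hkS.trans (hSR.le.trans (by gcongr))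
    _ = C * (J + R * S) := by rw [hC]; ring
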